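/- Let $c\ge 1$ be an integer. For two permutations $\sigma_s,\sigma_t$ of $[n]$, a common subsequence is a nonempty sequence of elements of $[n]$ that is a subsequence of both words $\sigma_s(1)\cdots\sigma_s(n)$ and $\sigma_t(1)\cdots\sigma_t(n)$. For two $k$-tuples of permutations $\Gamma_s=(\sigma_s^1,\dots,\sigma_s^k)$ and $\Gamma_t=(\sigma_t^1,\dots,\sigma_t^k)$ of $[n]$, a set $B\subseteq[n]$ is a feasible solution if for every $i\in\{1,\dots,k\}$ the set $B$ is the set of elements of some common subsequence of $\sigma_s^i$ and $\sigma_t^i$. The problem $n^{1/c}\mathrm{LFSD}$ is: given $\langle\Gamma_s,\Gamma_t\rangle$ with $k=n^{1/c}$ (so $n=k^c$) and an integer $l\ge 0$, decide whether there is a feasible solution $B$ with $|B|=l$; its parameter is $l$. An fpt-reduction from a parameterized problem $(A,\kappa_A)$ to a parameterized problem $(B,\kappa_B)$ is a map $R$ from instances to instances such that (1) $x\in A$ if and only if $R(x)\in B$; (2) $R(x)$ is computable in time $f(\kappa_A(x))\,p(|x|)$ for some computable $f$ and some polynomial $p$; (3) $\kappa_B(R(x))\le h(\kappa_A(x))$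 for some computable $h$. The class $W[1]$ consists of the parameterized problems that are fpt-reducible, for some first-order formula $\varphi(X)=\forall x_1\cdots\forall x_m\,\psi$ with $\psi$ quantifier-free over a finite relational vocabulary together with equality and one further relation variable $X$ of some arity $s$, to the problem: given a finite structure $\mathcal A$ with universe $U$ and an integer $k\ge 0$ (the parameter), decide whether there is $S\subseteq U^s$ with $|S|=k$ and $\mathcal A\models\varphi(S)$. Theorem. For every integer constant $c\ge 1$, the problem $n^{1/c}\mathrm{LFSD}$, parameterized by the solution size $l$, is $W[1]$-hard: every problem in $W[1]$ is fpt-reducible to it. -/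

import Mathlib

/-! ### Machine model: random access machines with uniform cost -/

namespace RAM

/-- Arithmetic expressions over scalar registers and arrays: constants, register contents, array
cells (indirect addressing), addition, truncated subtraction and halving (rounded down).
There is no multiplication. -/
inductive Expr : Type
  | const (a : ℕ)
  | reg (r : ℕ)
  | load (arr : ℕ) (idx : Expr)
  | add (e₁ e₂ : Expr)
  | sub (e₁ e₂ : Expr)
  | half (e : Expr)

/-- Programs. A program mentions only finitely many registers and arrays. -/
inductive Cmd : Type
  | skip
  | assign (r : ℕ) (e : Expr)
  | store (arr : ℕ) (idx e : Expr)
  | emit (e : Expr)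
  | seq (P Q : Cmd)
  | cond (e : Expr) (P Q : Cmd)
  | loop (e : Expr) (P : Cmd)

/-- A configuration: scalar registers, arrays, and the write-only output tape. -/
structure State : Type where
  reg : ℕ → ℕ
  arr : ℕ → ℕ → ℕ
  out : List Bool

/-- The value of an expression. -/
def Expr.eval (s : State) : Expr → ℕ
  | .const a => a
  | .reg r => s.reg r
  | .load a i => s.arr a (i.eval s)
  | .add e₁ e₂ => e₁.eval s + e₂.eval s
  | .sub e₁ e₂ => e₁.eval s - e₂.eval s
  | .half e => e.eval s / 2

/-- `Exec P s t s'`: started in `s`, the program `P` halts in `s'` after exactly `t` steps.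
Every assignment, store, output of one bit and evaluation of a test is one step. (The expression
in it has a fixed size, so this is the uniform cost measure up to a constant factor that depends
on the program only.) In tests and outputs, nonzero means true. -/
inductive Exec : Cmd → State → ℕ → State → Prop
  | skip (s : State) : Exec .skip s 1 s
  | assign (r : ℕ) (e : Expr) (s : State) :
      Exec (.assign r e) s 1 { s with reg := Function.update s.reg r (e.eval s) }
  | store (a : ℕ) (i e : Expr) (s : State) :
      Exec (.store a i e) s 1
        { s with arr := Function.update s.arr a
                          (Function.update (s.arr a) (i.eval s) (e.eval s)) }
  | emit (e : Expr) (s : State) :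
      Exec (.emit e) s 1 { s with out := s.out ++ [decide (e.eval s ≠ 0)] }
  | seq {P Q : Cmd} {s s' s'' : State} {t t' : ℕ} :
      Exec P s t s' → Exec Q s' t' s'' → Exec (.seq P Q) s (t + t') s''
  | cond_true {e : Expr} {P Q : Cmd} {s s' : State} {t : ℕ} :
      e.eval s ≠ 0 → Exec P s t s' → Exec (.cond e P Q) s (t + 1) s'
  | cond_false {e : Expr} {P Q : Cmd} {s s' : State} {t : ℕ} :
      e.eval s = 0 → Exec Q s t s' → Exec (.cond e P Q) s (t + 1) s'
  | loop_false {e : Expr} {P : Cmd} {s : State} :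
      e.eval s = 0 → Exec (.loop e P) s 1 s
  | loop_true {e : Expr} {P : Cmd} {s s' s'' : State} {t t' : ℕ} :
      e.eval s ≠ 0 → Exec P s t s' → Exec (.loop e P) s' t' s'' →
      Exec (.loop e P) s (t + t' + 1) s''

/-- The initial configuration on input `w`: register `0` holds the length of `w`, array `0` holds
the bits of `w`, everything else is `0`, and the output tape is empty. -/
def init (w : List Bool) : State where
  reg := Function.update (fun _ => 0) 0 w.length
  arr := Function.update (fun _ _ => 0) 0 (fun i => (w.getD i false).toNat)
  out := []

/-- On input `w`, the program `P` halts within `T` steps with `v` on the output tape. -/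
def OutputsWithin (P : Cmd) (w v : List Bool) (T : ℕ) : Prop :=
  ∃ (t : ℕ) (s : State), t ≤ T ∧ Exec P (init w) t s ∧ s.out = v

end RAM

/-! ### Parameterized problems, fpt-reductions, `W[1]` -/

/-- A parameterized decision problem: instances, encoded as words over `{0,1}`, the set of
yes-instances, and the parameter. -/
structure ParamProblem where
  Inst : Type
  encode : Inst → List Bool
  encode_injective : Function.Injective encode
  yes : Inst → Prop
  param : Inst → ℕ

/-- There is an fpt-reduction `R` from `A` to `B`: it preserves and reflects yes-instances, it is
computable in time `f (κ x) * p |x|` with `f` computable and `p` a polynomial, and the new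
parameter is at most `h (κ x)` with `h` computable. -/
def FPTReducible (A B : ParamProblem) : Prop :=
  ∃ (R : A.Inst → B.Inst) (P : RAM.Cmd) (f h : ℕ → ℕ) (p : Polynomial ℕ),
    Computable f ∧ Computable h ∧
    (∀ x, A.yes x ↔ B.yes (R x)) ∧
    (∀ x, RAM.OutputsWithin P (A.encode x) (B.encode (R x))
      (f (A.param x) * p.eval (A.encode x).length)) ∧
    (∀ x, B.param (R x) ≤ h (A.param x))

/-- The word `1^{a₁} 0 1^{a₂} 0 ⋯` for a list of natural numbers `a₁, a₂, …`. -/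
def encodeNats (l : List ℕ) : List Bool :=
  l.flatMap fun a => List.replicate a true ++ [false]

theorem encodeNats_injective : Function.Injective encodeNats := by
  intro l
  induction l with
  | nil =>
    intro l' h
    cases l' with
    | nil => rfl
    | cons b l' => simp [encodeNats] at h
  | cons a l ih =>
    intro l' h
    cases l' with
    | nil => simp [encodeNats] at h
    | cons b l' =>
      have key : ∀ (a b : ℕ) (u v : List Bool),
          List.replicate a true ++ false :: u = List.replicate b true ++ false :: v →
            a = b ∧ u = v := by
        intro a
        induction a with
        | zero =>
          intro b u v h
          cases b <;> simp_all [List.replicate_succ]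
        | succ a iha =>
          intro b u v h
          cases b with
          | zero => simp [List.replicate_succ] at h
          | succ b =>
            simp only [List.replicate_succ, List.cons_append, List.cons.injEq, true_and] at h
            obtain ⟨h₁, h₂⟩ := iha b u v h
            exact ⟨by rw [h₁], h₂⟩
      have h' : List.replicate a true ++ false :: encodeNats l
          = List.replicate b true ++ false :: encodeNats l' := by
        simpa [encodeNats] using h
      obtain ⟨h₁, h₂⟩ := key a b _ _ h'
      rw [h₁, ih h₂]

theorem flatten_ofFn_injective {α : Type} {k : ℕ} {F G : Fin k → List α}
    (hlen : ∀ i, (F i).length = (G i).length)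
    (h : (List.ofFn F).flatten = (List.ofFn G).flatten) : F = G := by
  apply List.ofFn_injective
  rw [List.eq_iff_flatten_eq]
  refine ⟨h, ?_⟩
  rw [List.map_ofFn, List.map_ofFn]
  congr 1
  funext i
  exact hlen i

/-- Quantifier-free first-order formulas in the variables `x_0, …, x_{m-1}` over the relational
vocabulary with arities listed in `τ`, equality, and one additional relation variable `X` of
arity `s`. -/
inductive QFree (τ : List ℕ) (s m : ℕ) : Type
  | eq (i j : Fin m)
  | rel (q : Fin τ.length) (v : Fin (τ.get q) → Fin m)
  | X (v : Fin s → Fin m)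
  | neg (φ : QFree τ s m)
  | and (φ ψ : QFree τ s m)

/-- A finite structure over the vocabulary `τ` (nonempty universe `Fin n`) with a number `k`. -/
structure WDInstance (τ : List ℕ) : Type where
  n : ℕ
  n_pos : 0 < n
  rel : ∀ q : Fin τ.length, (Fin (τ.get q) → Fin n) → Bool
  k : ℕ

/-- Satisfaction of a quantifier-free formula, with `S` as the value of `X` and `a` as the values
of the individual variables. -/
def QFree.Holds {τ : List ℕ} {s m : ℕ} (x : WDInstance τ) (S : Finset (Fin s → Fin x.n))
    (a : Fin m → Fin x.n) : QFree τ s m → Prop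
  | .eq i j => a i = a j
  | .rel q v => x.rel q (fun i => a (v i)) = true
  | .X v => (fun i => a (v i)) ∈ S
  | .neg φ => ¬ φ.Holds x S a
  | .and φ ψ => φ.Holds x S a ∧ ψ.Holds x S a

/-- The encoding of `(structure, k)`: the size of the universe, `k`, and the truth table of every
relation, the tuples being listed in the order of their value as base-`n` numerals. -/
def WDInstance.encode {τ : List ℕ} (x : WDInstance τ) : List Bool :=
  encodeNats (x.n :: x.k ::
    (List.ofFn fun q : Fin τ.length =>
      List.ofFn fun j : Fin (x.n ^ τ.get q) => (x.rel q (finFunctionFinEquiv.symm j)).toNat).flatten)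

theorem WDInstance.encode_injective {τ : List ℕ} :
    Function.Injective (WDInstance.encode (τ := τ)) := by
  rintro ⟨n, hn, r, k⟩ ⟨n', hn', r', k'⟩ h
  have h := encodeNats_injective h
  simp only [List.cons.injEq] at h
  obtain ⟨rfl, rfl, h⟩ := h
  have h := flatten_ofFn_injective (by simp) h
  have : r = r' := by
    funext q v
    have hq := List.ofFn_injective (congrFun h q)
    have hv := congrFun hq (finFunctionFinEquiv v)
    simp only [Equiv.symm_apply_apply] at hv
    revert hv
    cases r q v <;> cases r' q v <;> simp
  subst this
  rfl

/-- The parameterized weighted Fagin definability problem of the `Π₁`-formula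
`φ(X) = ∀ x_0 ⋯ x_{m-1}, ψ`: given a finite structure `𝒜` and a number `k` (the parameter), is
there a relation `S ⊆ 𝒜^s` with exactly `k` elements such that `𝒜 ⊨ φ(S)`? -/
def weightedDef (τ : List ℕ) (s m : ℕ) (ψ : QFree τ s m) : ParamProblem where
  Inst := WDInstance τ
  encode := WDInstance.encode
  encode_injective := WDInstance.encode_injective
  yes x := ∃ S : Finset (Fin s → Fin x.n), S.card = x.k ∧ ∀ a : Fin m → Fin x.n, ψ.Holds x S a
  param x := x.k

/-- The class `W[1]`: the closure, under fpt-reductions, of the weighted Fagin definability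
problems of `Π₁`-formulas. -/
def InW1 (A : ParamProblem) : Prop :=
  ∃ (τ : List ℕ) (s m : ℕ) (ψ : QFree τ s m), FPTReducible A (weightedDef τ s m ψ)

/-- `W[1]`-hardness under fpt-reductions. -/
def W1Hard (B : ParamProblem) : Prop :=
  ∀ A : ParamProblem, InW1 A → FPTReducible A B

/-! ### The largest fixed subset problem -/

/-- The (nonempty) common subsequences of two permutations, as words. -/
def commonSubseq {n : ℕ} (σs σt : Equiv.Perm (Fin n)) : Set (List (Fin n)) :=
  {b | 1 ≤ b.length ∧ b.length ≤ n ∧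
    b.Pairwise fun u v => σs.symm u < σs.symm v ∧ σt.symm u < σt.symm v}

/-- `B` is a feasible solution of a pair of `k`-tuples of permutations if it is the set of elements
of a common subsequence of the `i`-th permutations, for every `i`. -/
def IsFeasible {n k : ℕ} (Γs Γt : Fin k → Equiv.Perm (Fin n)) (B : Finset (Fin n)) : Prop :=
  ∀ i, ∃ b ∈ commonSubseq (Γs i) (Γt i), b.toFinset = B

/-- Instances of the decision version: two `k`-tuples of permutations of an `n`-element set and a
number `l`. -/
structure LFSDInstance : Type where
  n : ℕ
  k : ℕ
  Γs : Fin k → Equiv.Perm (Fin n)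
  Γt : Fin k → Equiv.Perm (Fin n)
  l : ℕ

/-- The encoding: `n`, `k`, `l`, and the words `σ(0) σ(1) ⋯ σ(n-1)` of all the permutations. -/
def LFSDInstance.encode (x : LFSDInstance) : List Bool :=
  encodeNats (x.n :: x.k :: x.l ::
    ((List.ofFn fun i => List.ofFn fun j => (x.Γs i j : ℕ)).flatten ++
      (List.ofFn fun i => List.ofFn fun j => (x.Γt i j : ℕ)).flatten))

theorem LFSDInstance.encode_injective : Function.Injective LFSDInstance.encode := by
  rintro ⟨n, k, s, t, l⟩ ⟨n', k', s', t', l'⟩ h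
  have h := encodeNats_injective h
  simp only [List.cons.injEq] at h
  obtain ⟨rfl, rfl, rfl, h⟩ := h
  have hlen : ∀ u : Fin k → Equiv.Perm (Fin n),
      (List.ofFn fun i => List.ofFn fun j => (u i j : ℕ)).flatten.length = k * n := by
    intro u
    simp [List.length_flatten, List.map_ofFn, Function.comp_def]
  obtain ⟨h₁, h₂⟩ := List.append_inj h (by rw [hlen, hlen])
  have inj : ∀ u v : Fin k → Equiv.Perm (Fin n),
      (List.ofFn fun i => List.ofFn fun j => (u i j : ℕ)).flatten
        = (List.ofFn fun i => List.ofFn fun j => (v i j : ℕ)).flatten → u = v := by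
    intro u v huv
    have huv := flatten_ofFn_injective (by simp) huv
    funext i
    apply Equiv.ext
    intro j
    exact Fin.ext (congrFun (List.ofFn_injective (congrFun huv i)) j)
  rw [inj _ _ h₁, inj _ _ h₂]

/-- The problem `n^{1/c}`-LFSD: given two `k`-tuples of permutations of an `n`-element set, where
`k = n^{1/c}`, and a number `l` (the parameter), is there a feasible solution with exactly `l`
elements? -/
def rootLFSD (c : ℕ) : ParamProblem where
  Inst := {x : LFSDInstance // x.k ^ c = x.n}
  encode x := x.1.encode
  encode_injective := LFSDInstance.encode_injective.comp Subtype.val_injective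
  yes x := ∃ B : Finset (Fin x.1.n), B.card = x.1.l ∧ IsFeasible x.1.Γs x.1.Γt B
  param x := x.1.l

/-!
Weighted definability by a `Π₁`-formula `∀ a, ψ` over structures with `n` elements reduces to a
clique problem, and that one to the largest fixed subset problem, by a map that is computable in
polynomial time.

*From definability to cliques.* A relation with `k` elements is a set of `k` numbers between `1`
and `N = n ^ s`. Together with `0` and `N + 1` they form a sequence
`0 = L 0 < ⋯ < L (k + 1) = N + 1`, which cuts the numbers of all tuples into blocks `[L j, L (j + 1))`. If a block contains the
number of a tuple, then this block alone tells whether the tuple belongs to the relation: it does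
if and only if it is the first number of the block. Hence positive and negative atoms are treated
alike, and whether `ψ` holds for an assignment depends on a bounded number of blocks, one for each
of the `m ^ s` atoms `X (…)`. A vertex of the graph is a sequence of boundedly many blocks, each
given with its index `j`, that violates `ψ` for no assignment; vertices are adjacent if their
blocks may belong to one sequence `L`. Vertices with the same sequence of indices are not
adjacent, so a clique with one vertex for every sequence of indices, that is
`(k + 2) ^ (m ^ s + 1)` vertices, is the same as a solution (`WDInstance.exists_isSolution_iff`,
`WDInstance.exists_clique_iff`).

*From cliques to common subsequences.* A set is the element set of a common subsequence of two
permutations if and only if it is nonempty and both order it in the same way. For a graph with the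
vertices `0, …, V - 1` take `V` pairs of permutations of `V ^ c` elements. The pair with number
`u` disagrees, among the vertices, exactly on the order of `u` and its non-neighbours; the
superfluous elements come last in the first permutation, and first, in reverse order, in the
second one. So the feasible sets with at least two elements are the cliques
(`exists_isFeasible_starInstance_iff`).

*Computation.* All functions involved are definable by arithmetic terms with bounded sums over the
encoding of the given structure. Such terms can be compiled to programs, and as all values are
bounded by polynomials, these run in polynomial time (`RAM.BTerm.exec_compile`,
`RAM.BOut.exec_compile`). The reduction that is given by membership in `W[1]` is prepended by
having its program write its output into a fresh array (`RAM.Exec.redirect`); since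
`r (y * z) ≤ r y * r z` for polynomials `r` with natural coefficients, the total time has the required form
(`FPTReducible.trans_expressible`).
-/

/-! ### Turning output into input: redirecting the output tape into an array -/

namespace RAM

/-- Every register and every array mentioned in the expression has an index below `b`. -/
def Expr.Below (b : ℕ) : Expr → Prop
  | .const _ => True
  | .reg r => r < b
  | .load a i => a < b ∧ i.Below b
  | .add e₁ e₂ => e₁.Below b ∧ e₂.Below b
  | .sub e₁ e₂ => e₁.Below b ∧ e₂.Below b
  | .half e => e.Below b

/-- Every register and every array mentioned in the program has an index below `b`. -/
def Cmd.Below (b : ℕ) : Cmd → Prop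
  | .skip => True
  | .assign r e => r < b ∧ e.Below b
  | .store a i e => a < b ∧ i.Below b ∧ e.Below b
  | .emit e => e.Below b
  | .seq P Q => P.Below b ∧ Q.Below b
  | .cond e P Q => e.Below b ∧ P.Below b ∧ Q.Below b
  | .loop e P => e.Below b ∧ P.Below b

theorem Expr.Below.mono {b b' : ℕ} (h : b ≤ b') {e : Expr} (he : e.Below b) : e.Below b' := by
  induction e with
  | const a => trivial
  | reg r => exact lt_of_lt_of_le he h
  | load a i ih => exact ⟨lt_of_lt_of_le he.1 h, ih he.2⟩
  | add e₁ e₂ ih₁ ih₂ => exact ⟨ih₁ he.1, ih₂ he.2⟩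
  | sub e₁ e₂ ih₁ ih₂ => exact ⟨ih₁ he.1, ih₂ he.2⟩
  | half e ih => exact ih (by exact he)

theorem Cmd.Below.mono {b b' : ℕ} (h : b ≤ b') {P : Cmd} (hP : P.Below b) : P.Below b' := by
  induction P with
  | skip => trivial
  | assign r e => exact ⟨lt_of_lt_of_le hP.1 h, hP.2.mono h⟩
  | store a i e => exact ⟨lt_of_lt_of_le hP.1 h, hP.2.1.mono h, hP.2.2.mono h⟩
  | emit e => exact Expr.Below.mono h (by exact hP)
  | seq P Q ihP ihQ => exact ⟨ihP hP.1, ihQ hP.2⟩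
  | cond e P Q ihP ihQ => exact ⟨hP.1.mono h, ihP hP.2.1, ihQ hP.2.2⟩
  | loop e P ihP => exact ⟨hP.1.mono h, ihP hP.2⟩

theorem Expr.exists_below (e : Expr) : ∃ b, e.Below b := by
  induction e with
  | const a => exact ⟨0, trivial⟩
  | reg r => exact ⟨r + 1, Nat.lt_succ_self r⟩
  | load a i ih =>
    obtain ⟨b, hb⟩ := ih
    exact ⟨b + a + 1, by omega, hb.mono (by omega)⟩
  | add e₁ e₂ ih₁ ih₂ =>
    obtain ⟨b, hb⟩ := ih₁
    obtain ⟨b', hb'⟩ := ih₂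
    exact ⟨b + b', hb.mono (by omega), hb'.mono (by omega)⟩
  | sub e₁ e₂ ih₁ ih₂ =>
    obtain ⟨b, hb⟩ := ih₁
    obtain ⟨b', hb'⟩ := ih₂
    exact ⟨b + b', hb.mono (by omega), hb'.mono (by omega)⟩
  | half e ih =>
    obtain ⟨b, hb⟩ := ih
    exact ⟨b, hb⟩

theorem Cmd.exists_below (P : Cmd) : ∃ b, P.Below b := by
  induction P with
  | skip => exact ⟨0, trivial⟩
  | assign r e =>
    obtain ⟨b, hb⟩ := e.exists_below
    exact ⟨b + r + 1, by omega, hb.mono (by omega)⟩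
  | store a i e =>
    obtain ⟨b, hb⟩ := e.exists_below
    obtain ⟨b', hb'⟩ := i.exists_below
    exact ⟨b + b' + a + 1, by omega, hb'.mono (by omega), hb.mono (by omega)⟩
  | emit e => exact e.exists_below
  | seq P Q ihP ihQ =>
    obtain ⟨b, hb⟩ := ihP
    obtain ⟨b', hb'⟩ := ihQ
    exact ⟨b + b', hb.mono (by omega), hb'.mono (by omega)⟩
  | cond e P Q ihP ihQ =>
    obtain ⟨b, hb⟩ := ihP
    obtain ⟨b', hb'⟩ := ihQ
    obtain ⟨b'', hb''⟩ := e.exists_below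
    exact ⟨b + b' + b'', hb''.mono (by omega), hb.mono (by omega), hb'.mono (by omega)⟩
  | loop e P ihP =>
    obtain ⟨b, hb⟩ := ihP
    obtain ⟨b', hb'⟩ := e.exists_below
    exact ⟨b + b', hb'.mono (by omega), hb.mono (by omega)⟩

/-- The program that writes into array `b` what `P` writes on the output tape; register `b` counts
the bits written so far. -/
def Cmd.redirect (b : ℕ) : Cmd → Cmd
  | .skip => .skip
  | .assign r e => .assign r e
  | .store a i e => .store a i e
  | .emit e => .seq (.store b (.reg b) (.sub (.const 1) (.sub (.const 1) e)))
      (.assign b (.add (.reg b) (.const 1)))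
  | .seq P Q => .seq (P.redirect b) (Q.redirect b)
  | .cond e P Q => .cond e (P.redirect b) (Q.redirect b)
  | .loop e P => .loop e (P.redirect b)

/-- The word `w` is stored in array `b`, and its length in register `b`. -/
structure HasWord (s : State) (b : ℕ) (w : List Bool) : Prop where
  len : s.reg b = w.length
  bit : ∀ i, s.arr b i = (w.getD i false).toNat

/-- The state `s'` agrees with `s` on the registers and arrays below `b`, and holds the output of
`s` as a stored word while its own output tape is empty. -/
structure Redirects (b : ℕ) (s s' : State) : Prop where
  reg : ∀ r < b, s'.reg r = s.reg r
  arr : ∀ a < b, s'.arr a = s.arr a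
  word : HasWord s' b s.out
  out : s'.out = []

theorem Redirects.eval_eq {b : ℕ} {s s' : State} (h : Redirects b s s') {e : Expr}
    (he : e.Below b) : e.eval s' = e.eval s := by
  induction e with
  | const a => rfl
  | reg r => exact h.reg r he
  | load a i ih => simp only [Expr.eval, ih he.2, h.arr a he.1]
  | add e₁ e₂ ih₁ ih₂ => simp only [Expr.eval, ih₁ he.1, ih₂ he.2]
  | sub e₁ e₂ ih₁ ih₂ => simp only [Expr.eval, ih₁ he.1, ih₂ he.2]
  | half e ih => simp only [Expr.eval]; rw [ih (by exact he)]

theorem Exec.redirect {b : ℕ} {P : Cmd} {s₁ s₂ : State} {t : ℕ} (h : Exec P s₁ t s₂)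
    (hP : P.Below b) : ∀ {s₁' : State}, Redirects b s₁ s₁' →
      ∃ t' s₂', Exec (P.redirect b) s₁' t' s₂' ∧ Redirects b s₂ s₂' ∧ t' ≤ 2 * t := by
  induction h with
  | skip s => exact fun {s₁'} hs => ⟨1, s₁', Exec.skip _, hs, by omega⟩
  | assign r e s =>
    intro s₁' hs
    refine ⟨1, _, Exec.assign r e s₁', ⟨?_, hs.arr, ⟨?_, hs.word.bit⟩, hs.out⟩, by omega⟩
    · intro r' hr'
      simp only [hs.eval_eq hP.2, Function.update_apply, hs.reg r' hr']
    · have : b ≠ r := by have := hP.1; omega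
      simpa only [Function.update_of_ne this] using hs.word.len
  | store a i e s =>
    intro s₁' hs
    refine ⟨1, _, Exec.store a i e s₁', ⟨hs.reg, ?_, ⟨hs.word.len, ?_⟩, hs.out⟩, by omega⟩
    · intro a' ha'
      simp only [hs.eval_eq hP.2.1, hs.eval_eq hP.2.2, Function.update_apply, hs.arr a' ha',
        hs.arr a hP.1]
    · have : b ≠ a := by have := hP.1; omega
      simpa only [Function.update_of_ne this] using hs.word.bit
  | emit e s =>
    intro s₁' hs
    refine ⟨1 + 1, _, Exec.seq (Exec.store _ _ _ _) (Exec.assign _ _ _),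
      ⟨?_, ?_, ⟨?_, ?_⟩, hs.out⟩, by omega⟩
    · intro r hr
      simpa only [Function.update_of_ne (by omega : r ≠ b)] using hs.reg r hr
    · intro a ha
      simpa only [Function.update_of_ne (by omega : a ≠ b)] using hs.arr a ha
    · simp [Expr.eval, hs.word.len]
    · intro i
      have he : e.eval s₁' = e.eval s := hs.eval_eq hP
      simp only [Expr.eval, Function.update_self, he, hs.word.len]
      rcases lt_trichotomy i s.out.length with hi | rfl | hi
      · rw [Function.update_of_ne (by omega), hs.word.bit, List.getD_append _ _ _ _ hi]
      · rw [Function.update_self, List.getD_append_right _ _ _ _ le_rfl]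
        by_cases h0 : e.eval s = 0
        · simp [h0]
        · simp [h0]; omega
      · rw [Function.update_of_ne (by omega), hs.word.bit, List.getD_eq_default _ _ hi.le,
          List.getD_eq_default _ _ (by simp; omega)]
  | seq _ _ ih₁ ih₂ =>
    intro s₁' hs
    obtain ⟨t', u, hE, hu, ht⟩ := ih₁ hP.1 hs
    obtain ⟨t'', u', hE', hu', ht'⟩ := ih₂ hP.2 hu
    exact ⟨_, _, Exec.seq hE hE', hu', by omega⟩
  | cond_true he _ ih =>
    intro s₁' hs
    obtain ⟨t', u, hE, hu, ht⟩ := ih hP.2.1 hs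
    exact ⟨_, _, Exec.cond_true (by rwa [hs.eval_eq hP.1]) hE, hu, by omega⟩
  | cond_false he _ ih =>
    intro s₁' hs
    obtain ⟨t', u, hE, hu, ht⟩ := ih hP.2.2 hs
    exact ⟨_, _, Exec.cond_false (by rwa [hs.eval_eq hP.1]) hE, hu, by omega⟩
  | loop_false he =>
    intro s₁' hs
    exact ⟨_, _, Exec.loop_false (by rwa [hs.eval_eq hP.1]), hs, by omega⟩
  | loop_true he _ _ ih₁ ih₂ =>
    intro s₁' hs
    obtain ⟨t', u, hE, hu, ht⟩ := ih₁ hP.2 hs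
    obtain ⟨t'', u', hE', hu', ht'⟩ := ih₂ hP hu
    exact ⟨_, _, Exec.loop_true (by rwa [hs.eval_eq hP.1]) hE hE', hu', by omega⟩

theorem Exec.length_out_le {P : Cmd} {s s' : State} {t : ℕ} (h : Exec P s t s') :
    s'.out.length ≤ s.out.length + t := by
  induction h with
  | emit e s => simp
  | _ => first | omega | simp

theorem redirects_init {b : ℕ} (hb : 0 < b) (w : List Bool) : Redirects b (init w) (init w) := by
  refine ⟨fun _ _ => rfl, fun _ _ => rfl, ⟨?_, fun i => ?_⟩, rfl⟩ <;>
    simp [init, Function.update_of_ne hb.ne']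

/-- A halting program can be replaced by one that leaves the output, as a stored word, in registers
and arrays that can be read again. -/
theorem OutputsWithin.hasWord {P : Cmd} {w v : List Bool} {T b : ℕ} (hb : 0 < b) (hP : P.Below b)
    (h : OutputsWithin P w v T) :
    v.length ≤ T ∧ ∃ t s, t ≤ 2 * T ∧ Exec (P.redirect b) (init w) t s ∧ HasWord s b v ∧
      s.out = [] := by
  obtain ⟨t, s, ht, hE, rfl⟩ := h
  obtain ⟨t', s', hE', hs', ht'⟩ := hE.redirect hP (redirects_init hb w)
  refine ⟨?_, t', s', by omega, hE', hs'.word, hs'.out⟩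
  have := hE.length_out_le
  simp only [init, List.length_nil] at this
  omega

end RAM

/-! ### Terms with bounded sums and their compilation -/

theorem Polynomial.eval_mono_nat (p : Polynomial ℕ) : Monotone fun x => p.eval x := by
  intro x y h
  simp only [Polynomial.eval_eq_sum_range]
  exact Finset.sum_le_sum fun i _ => Nat.mul_le_mul_left _ (Nat.pow_le_pow_left h i)

namespace RAM

/-- Arithmetic terms about a binary word. Variables are de Bruijn indices; `bit t` is the bit of the
word at position `t` (`0` beyond its end), `sub` is truncated, and `bsum t u` is the sum of `u` over
all values below `t` of its variable `0`. -/
inductive BTerm : Type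
  | var (i : ℕ)
  | const (a : ℕ)
  | len
  | bit (t : BTerm)
  | add (t u : BTerm)
  | sub (t u : BTerm)
  | bsum (t u : BTerm)

/-- Extension of a valuation by a new variable `0`. -/
def push (a : ℕ) (ρ : ℕ → ℕ) : ℕ → ℕ
  | 0 => a
  | i + 1 => ρ i

/-- The value of a term for the word `w` and the valuation `ρ`. -/
def BTerm.eval (w : List Bool) : BTerm → (ℕ → ℕ) → ℕ
  | .var i, ρ => ρ i
  | .const a, _ => a
  | .len, _ => w.length
  | .bit t, ρ => (w.getD (t.eval w ρ) false).toNat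
  | .add t u, ρ => t.eval w ρ + u.eval w ρ
  | .sub t u, ρ => t.eval w ρ - u.eval w ρ
  | .bsum t u, ρ => ∑ a ∈ Finset.range (t.eval w ρ), u.eval w (push a ρ)

/-- A program that evaluates a term on the word stored at `b`. The variable `i` is held in register
`vr i`, registers from `d` on are free for use, and the value is left in register `d`. -/
def BTerm.compile (b : ℕ) : BTerm → (ℕ → ℕ) → ℕ → Cmd
  | .var i, vr, d => .assign d (.reg (vr i))
  | .const a, _, d => .assign d (.const a)
  | .len, _, d => .assign d (.reg b)
  | .bit t, vr, d => .seq (t.compile b vr d) (.assign d (.load b (.reg d)))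
  | .add t u, vr, d => .seq (t.compile b vr d) (.seq (u.compile b vr (d + 1))
      (.assign d (.add (.reg d) (.reg (d + 1)))))
  | .sub t u, vr, d => .seq (t.compile b vr d) (.seq (u.compile b vr (d + 1))
      (.assign d (.sub (.reg d) (.reg (d + 1)))))
  | .bsum t u, vr, d => .seq (t.compile b vr d) (.seq (.assign (d + 1) (.const 0))
      (.seq (.assign (d + 2) (.const 0)) (.seq
        (.loop (.sub (.reg d) (.reg (d + 2))) (.seq (u.compile b (push (d + 2) vr) (d + 3))
          (.seq (.assign (d + 1) (.add (.reg (d + 1)) (.reg (d + 3))))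
            (.assign (d + 2) (.add (.reg (d + 2)) (.const 1))))))
        (.assign d (.reg (d + 1))))))

theorem push_le {a B : ℕ} {ρ : ℕ → ℕ} (ha : a ≤ B) (hρ : ∀ i, ρ i ≤ B) : ∀ i, push a ρ i ≤ B
  | 0 => ha
  | i + 1 => hρ i

/-- Values of terms are polynomially bounded in the length of the word and the variables. -/
theorem BTerm.exists_eval_le (t : BTerm) : ∃ p : Polynomial ℕ,
    ∀ (w : List Bool) (ρ : ℕ → ℕ) (B : ℕ), w.length ≤ B → (∀ i, ρ i ≤ B) →
      t.eval w ρ ≤ p.eval B := by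
  induction t with
  | var i => exact ⟨.X, fun w ρ B _ hρ => by simpa [eval] using hρ i⟩
  | const a => exact ⟨.C a, fun w ρ B _ _ => by simp [eval]⟩
  | len => exact ⟨.X, fun w ρ B hw _ => by simpa [eval] using hw⟩
  | bit t _ => exact ⟨1, fun w ρ B _ _ => by simpa [eval] using Bool.toNat_le _⟩
  | add t u iht ihu =>
    obtain ⟨p, hp⟩ := iht
    obtain ⟨q, hq⟩ := ihu
    exact ⟨p + q, fun w ρ B hw hρ => by
      simpa [eval] using Nat.add_le_add (hp w ρ B hw hρ) (hq w ρ B hw hρ)⟩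
  | sub t u iht ihu =>
    obtain ⟨p, hp⟩ := iht
    exact ⟨p, fun w ρ B hw hρ => (Nat.sub_le _ _).trans (hp w ρ B hw hρ)⟩
  | bsum t u iht ihu =>
    obtain ⟨p, hp⟩ := iht
    obtain ⟨q, hq⟩ := ihu
    refine ⟨p * q.comp (p + .X), fun w ρ B hw hρ => ?_⟩
    simp only [eval, Polynomial.eval_mul, Polynomial.eval_comp, Polynomial.eval_add,
      Polynomial.eval_X]
    refine (Finset.sum_le_card_nsmul _ _ (q.eval (p.eval B + B)) fun a ha => ?_).trans ?_
    · have ha' := (Finset.mem_range.1 ha).le.trans (hp w ρ B hw hρ)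
      exact hq w _ _ (by omega) (push_le (by omega) fun i => (hρ i).trans (by omega))
    · simpa using Nat.mul_le_mul_right _ (hp w ρ B hw hρ)

/-- Total correctness of a loop, from an invariant `Inv j` that holds after `j` rounds. -/
theorem Exec.loop_of_invariant {e : Expr} {P : Cmd} (Inv : ℕ → State → Prop) {m K : ℕ}
    (step : ∀ j < m, ∀ s, Inv j s →
      e.eval s ≠ 0 ∧ ∃ t s', Exec P s t s' ∧ t ≤ K ∧ Inv (j + 1) s')
    (halt : ∀ s, Inv m s → e.eval s = 0) {s : State} (hs : Inv 0 s) :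
    ∃ t s', Exec (.loop e P) s t s' ∧ t ≤ m * (K + 1) + 1 ∧ Inv m s' := by
  have key : ∀ r j s, j + r = m → Inv j s →
      ∃ t s', Exec (.loop e P) s t s' ∧ t ≤ r * (K + 1) + 1 ∧ Inv m s' := by
    intro r
    induction r with
    | zero =>
      rintro j s rfl hs
      exact ⟨1, s, Exec.loop_false (halt s hs), by omega, hs⟩
    | succ r ih =>
      intro j s hj hs
      obtain ⟨he, t, s', hE, ht, hs'⟩ := step j (by omega) s hs
      obtain ⟨t', s'', hE', ht', hs''⟩ := ih (j + 1) s' (by omega) hs'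
      exact ⟨_, _, Exec.loop_true he hE hE', by rw [Nat.succ_mul]; omega, hs''⟩
  exact key m 0 s (by omega) hs

/-- `s'` differs from `s` at most in the registers from `d` on and in the output. -/
structure Preserves (d : ℕ) (s s' : State) : Prop where
  reg : ∀ r < d, s'.reg r = s.reg r
  arr : s'.arr = s.arr

theorem Preserves.refl (d : ℕ) (s : State) : Preserves d s s := ⟨fun _ _ => rfl, rfl⟩

theorem Preserves.trans {d : ℕ} {s s' s'' : State} (h : Preserves d s s')
    (h' : Preserves d s' s'') : Preserves d s s'' :=
  ⟨fun r hr => (h'.reg r hr).trans (h.reg r hr), h'.arr.trans h.arr⟩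

theorem Preserves.mono {d d' : ℕ} {s s' : State} (h : Preserves d' s s') (hd : d ≤ d') :
    Preserves d s s' :=
  ⟨fun r hr => h.reg r (hr.trans_le hd), h.arr⟩

theorem Preserves.assign {d r : ℕ} (hr : d ≤ r) (s : State) (a : ℕ) :
    Preserves d s { s with reg := Function.update s.reg r a } :=
  ⟨fun r' hr' => Function.update_of_ne (by omega) _ _, rfl⟩

theorem HasWord.preserves {b d : ℕ} {s s' : State} {w : List Bool} (h : HasWord s b w)
    (hb : b < d) (hs : Preserves d s s') : HasWord s' b w :=
  ⟨(hs.reg b hb).trans h.len, fun i => by rw [hs.arr, h.bit]⟩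

/-- The state `s` holds the word `w` at `b` and the valuation `ρ` in the registers `vr`, all of
them below `d`. -/
structure Holds (b : ℕ) (w : List Bool) (vr ρ : ℕ → ℕ) (d : ℕ) (s : State) : Prop where
  word : HasWord s b w
  lt : b < d
  var_lt : ∀ i, vr i < d
  var : ∀ i, s.reg (vr i) = ρ i

theorem Holds.preserves {b d : ℕ} {w : List Bool} {vr ρ : ℕ → ℕ} {s s' : State}
    (h : Holds b w vr ρ d s) (hs : Preserves d s s') : Holds b w vr ρ d s' :=
  ⟨h.word.preserves h.lt hs, h.lt, h.var_lt, fun i => (hs.reg _ (h.var_lt i)).trans (h.var i)⟩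

theorem Holds.mono {b d d' : ℕ} {w : List Bool} {vr ρ : ℕ → ℕ} {s : State}
    (h : Holds b w vr ρ d s) (hd : d ≤ d') : Holds b w vr ρ d' s :=
  ⟨h.word, h.lt.trans_le hd, fun i => (h.var_lt i).trans_le hd, h.var⟩

theorem Holds.push {b d a r : ℕ} {w : List Bool} {vr ρ : ℕ → ℕ} {s : State}
    (h : Holds b w vr ρ d s) (hr : r < d) (ha : s.reg r = a) :
    Holds b w (push r vr) (push a ρ) d s :=
  ⟨h.word, h.lt, fun i => by cases i <;> [exact hr; exact h.var_lt _],
    fun i => by cases i <;> [exact ha; exact h.var _]⟩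

/-- Compiled terms are computed correctly, in polynomial time. -/
theorem BTerm.exec_compile (t : BTerm) : ∃ p : Polynomial ℕ,
    ∀ (b : ℕ) (w : List Bool) (vr ρ : ℕ → ℕ) (d : ℕ) (s : State) (B : ℕ),
      w.length ≤ B → (∀ i, ρ i ≤ B) → Holds b w vr ρ d s →
      ∃ T s', Exec (t.compile b vr d) s T s' ∧ T ≤ p.eval B ∧ s'.reg d = t.eval w ρ ∧
        Preserves d s s' ∧ s'.out = s.out := by
  induction t with
  | var i =>
    exact ⟨1, fun b w vr ρ d s B hw hρ hs => ⟨1, _, Exec.assign _ _ _, by simp,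
      by simp [Expr.eval, eval, hs.var], .assign le_rfl _ _, rfl⟩⟩
  | const a =>
    exact ⟨1, fun b w vr ρ d s B hw hρ hs => ⟨1, _, Exec.assign _ _ _, by simp,
      by simp [Expr.eval, eval], .assign le_rfl _ _, rfl⟩⟩
  | len =>
    exact ⟨1, fun b w vr ρ d s B hw hρ hs => ⟨1, _, Exec.assign _ _ _, by simp,
      by simp [Expr.eval, eval, hs.word.len], .assign le_rfl _ _, rfl⟩⟩
  | bit t ih =>
    obtain ⟨p, hp⟩ := ih
    refine ⟨p + 1, fun b w vr ρ d s B hw hρ hs => ?_⟩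
    obtain ⟨T, s', hE, hT, hv, hpr, ho⟩ := hp b w vr ρ d s B hw hρ hs
    refine ⟨T + 1, _, hE.seq (Exec.assign _ _ _), by simpa using hT, ?_,
      hpr.trans (.assign le_rfl _ _), ho⟩
    simp [Expr.eval, eval, hv, (hs.preserves hpr).word.bit]
  | add t u iht ihu =>
    obtain ⟨p, hp⟩ := iht
    obtain ⟨q, hq⟩ := ihu
    refine ⟨p + q + 1, fun b w vr ρ d s B hw hρ hs => ?_⟩
    obtain ⟨T, s', hE, hT, hv, hpr, ho⟩ := hp b w vr ρ d s B hw hρ hs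
    obtain ⟨T', s'', hE', hT', hv', hpr', ho'⟩ := hq b w vr ρ (d + 1) s' B hw hρ
      ((hs.preserves hpr).mono (by omega))
    refine ⟨T + (T' + 1), _, hE.seq (hE'.seq (Exec.assign _ _ _)), ?_, ?_,
      hpr.trans ((hpr'.mono (by omega)).trans (.assign le_rfl _ _)), ho'.trans ho⟩
    · simp only [Polynomial.eval_add, Polynomial.eval_one]; omega
    · simp [Expr.eval, eval, hv', hpr'.reg d (by omega), hv]
  | sub t u iht ihu =>
    obtain ⟨p, hp⟩ := iht
    obtain ⟨q, hq⟩ := ihu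
    refine ⟨p + q + 1, fun b w vr ρ d s B hw hρ hs => ?_⟩
    obtain ⟨T, s', hE, hT, hv, hpr, ho⟩ := hp b w vr ρ d s B hw hρ hs
    obtain ⟨T', s'', hE', hT', hv', hpr', ho'⟩ := hq b w vr ρ (d + 1) s' B hw hρ
      ((hs.preserves hpr).mono (by omega))
    refine ⟨T + (T' + 1), _, hE.seq (hE'.seq (Exec.assign _ _ _)), ?_, ?_,
      hpr.trans ((hpr'.mono (by omega)).trans (.assign le_rfl _ _)), ho'.trans ho⟩
    · simp only [Polynomial.eval_add, Polynomial.eval_one]; omega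
    · simp [Expr.eval, eval, hv', hpr'.reg d (by omega), hv]
  | bsum t u iht ihu =>
    obtain ⟨p, hp⟩ := iht
    obtain ⟨q, hq⟩ := ihu
    obtain ⟨v, hv⟩ := t.exists_eval_le
    refine ⟨p + v * (q.comp (v + .X) + 3) + 4, fun b w vr ρ d s B hw hρ hs => ?_⟩
    obtain ⟨T, s', hE, hT, hval, hpr, ho⟩ := hp b w vr ρ d s B hw hρ hs
    have hm := hv w ρ B hw hρ
    set m := t.eval w ρ with hm_def
    have hs' := hs.preserves hpr
    -- After `j` rounds, the partial sum is in register `d + 1` and the index in register `d + 2`.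
    let Inv : ℕ → State → Prop := fun j z =>
      Preserves d s' z ∧ z.out = s'.out ∧ z.reg d = m ∧ z.reg (d + 2) = j ∧
        z.reg (d + 1) = ∑ a ∈ Finset.range j, u.eval w (RAM.push a ρ)
    obtain ⟨T', z, hE', hT', hz, hzo, hzd, hzj, hzv⟩ := Exec.loop_of_invariant
      (e := .sub (.reg d) (.reg (d + 2)))
      (P := .seq (u.compile b (RAM.push (d + 2) vr) (d + 3))
          (.seq (.assign (d + 1) (.add (.reg (d + 1)) (.reg (d + 3))))
            (.assign (d + 2) (.add (.reg (d + 2)) (.const 1)))))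
      Inv (m := m) (K := q.eval (v.eval B + B) + 2)
      (by
        rintro j hj z ⟨hz, hzo, hzd, hzj, hzv⟩
        refine ⟨by simp only [Expr.eval, hzd, hzj]; omega, ?_⟩
        obtain ⟨T₁, y, hE₁, hT₁, hy, hpy, hyo⟩ := hq b w (RAM.push (d + 2) vr) (RAM.push j ρ)
          (d + 3) z (v.eval B + B) (by omega)
          (push_le (by omega) fun i => (hρ i).trans (by omega))
          (((hs'.preserves hz).mono (by omega)).push (by omega) hzj)
        refine ⟨_, _, hE₁.seq ((Exec.assign _ _ _).seq (Exec.assign _ _ _)), by omega, ?_, ?_, ?_,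
          ?_, ?_⟩
        · exact hz.trans ((hpy.mono (by omega)).trans
            ((Preserves.assign (by omega) _ _).trans (.assign (by omega) _ _)))
        · exact hyo.trans hzo
        · simp [hpy.reg d (by omega), hzd]
        · simp [Expr.eval, hpy.reg (d + 2) (by omega), hzj]
        · simp [Expr.eval, hpy.reg (d + 1) (by omega), hzv, hy, Finset.sum_range_succ])
      (by
        rintro z ⟨-, -, hzd, hzj, -⟩
        simp [Expr.eval, hzd, hzj])
      (s := { s' with reg := Function.update (Function.update s'.reg (d + 1) 0) (d + 2) 0 })
      ⟨(Preserves.assign (by omega) _ _).trans (.assign (by omega) _ _), rfl, by simp [hval],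
        by simp, by simp⟩
    refine ⟨_, _, hE.seq ((Exec.assign _ _ _).seq ((Exec.assign _ _ _).seq
      (hE'.seq (Exec.assign _ _ _)))), ?_, ?_, hpr.trans (hz.trans (.assign le_rfl _ _)),
      hzo.trans ho⟩
    · simp only [Polynomial.eval_add, Polynomial.eval_mul, Polynomial.eval_comp, Polynomial.eval_X,
        Polynomial.eval_ofNat]
      change T' ≤ m * (q.eval (v.eval B + B) + 3) + 1 at hT'
      have := Nat.mul_le_mul_right (q.eval (v.eval B + B) + 3) hm
      omega
    · simp [Expr.eval, eval, hzv, ← hm_def]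

/-- Schemes for lists of natural numbers: a single number, concatenation, and the concatenation of
the lists obtained for all values of the variable `0` below a bound. -/
inductive BOut : Type
  | nat (t : BTerm)
  | append (o o' : BOut)
  | range (t : BTerm) (o : BOut)

/-- The list of numbers that a scheme describes. -/
def BOut.eval (w : List Bool) : BOut → (ℕ → ℕ) → List ℕ
  | .nat t, ρ => [t.eval w ρ]
  | .append o o', ρ => o.eval w ρ ++ o'.eval w ρ
  | .range t o, ρ => (List.range (t.eval w ρ)).flatMap fun a => o.eval w (push a ρ)

/-- A program that outputs the unary encoding of the list described by a scheme. -/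
def BOut.compile (b : ℕ) : BOut → (ℕ → ℕ) → ℕ → Cmd
  | .nat t, vr, d => .seq (t.compile b vr d)
      (.seq (.loop (.reg d) (.seq (.emit (.const 1)) (.assign d (.sub (.reg d) (.const 1)))))
        (.emit (.const 0)))
  | .append o o', vr, d => .seq (o.compile b vr d) (o'.compile b vr d)
  | .range t o, vr, d => .seq (t.compile b vr d) (.seq (.assign (d + 1) (.const 0))
      (.loop (.sub (.reg d) (.reg (d + 1))) (.seq (o.compile b (push (d + 1) vr) (d + 2))
        (.assign (d + 1) (.add (.reg (d + 1)) (.const 1))))))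

theorem encodeNats_append (l l' : List ℕ) :
    encodeNats (l ++ l') = encodeNats l ++ encodeNats l' := by
  simp [encodeNats]

/-- The described list is output correctly, in polynomial time. -/
theorem BOut.exec_compile (o : BOut) : ∃ p : Polynomial ℕ,
    ∀ (b : ℕ) (w : List Bool) (vr ρ : ℕ → ℕ) (d : ℕ) (s : State) (B : ℕ),
      w.length ≤ B → (∀ i, ρ i ≤ B) → Holds b w vr ρ d s →
      ∃ T s', Exec (o.compile b vr d) s T s' ∧ T ≤ p.eval B ∧
        Preserves d s s' ∧ s'.out = s.out ++ encodeNats (o.eval w ρ) := by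
  induction o with
  | nat t =>
    obtain ⟨p, hp⟩ := t.exec_compile
    obtain ⟨v, hv⟩ := t.exists_eval_le
    refine ⟨p + v * 3 + 2, fun b w vr ρ d s B hw hρ hs => ?_⟩
    obtain ⟨T, s', hE, hT, hval, hpr, ho⟩ := hp b w vr ρ d s B hw hρ hs
    have hm := hv w ρ B hw hρ
    set m := t.eval w ρ with hm_def
    obtain ⟨T', z, hE', hT', hz, hzd, hzo⟩ := Exec.loop_of_invariant (e := .reg d)
      (P := .seq (.emit (.const 1)) (.assign d (.sub (.reg d) (.const 1))))
      (fun j z => Preserves d s' z ∧ z.reg d = m - j ∧ z.out = s'.out ++ List.replicate j true)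
      (m := m) (K := 2)
      (by
        rintro j hj z ⟨hz, hzd, hzo⟩
        refine ⟨by simp only [Expr.eval, hzd]; omega, _, _,
          (Exec.emit _ _).seq (Exec.assign _ _ _), le_rfl, ?_, ?_, ?_⟩
        · exact hz.trans ⟨fun r hr => Function.update_of_ne (by omega) _ _, rfl⟩
        · simp only [Expr.eval, hzd, Function.update_self]; omega
        · simp [Expr.eval, hzo, List.replicate_succ'])
      (by
        rintro z ⟨-, hzd, -⟩
        simp [Expr.eval, hzd])
      (s := s') ⟨.refl _ _, by simp [hval], by simp⟩
    refine ⟨_, _, hE.seq (hE'.seq (Exec.emit _ _)), ?_, hpr.trans (hz.trans ⟨fun _ _ => rfl, rfl⟩),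
      ?_⟩
    · simp only [Polynomial.eval_add, Polynomial.eval_mul, Polynomial.eval_ofNat]
      omega
    · simp [Expr.eval, hzo, ho, eval, encodeNats, ← hm_def]
  | append o o' ih ih' =>
    obtain ⟨p, hp⟩ := ih
    obtain ⟨q, hq⟩ := ih'
    refine ⟨p + q, fun b w vr ρ d s B hw hρ hs => ?_⟩
    obtain ⟨T, s', hE, hT, hpr, ho⟩ := hp b w vr ρ d s B hw hρ hs
    obtain ⟨T', s'', hE', hT', hpr', ho'⟩ := hq b w vr ρ d s' B hw hρ (hs.preserves hpr)
    refine ⟨_, _, hE.seq hE', ?_, hpr.trans hpr', ?_⟩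
    · simp only [Polynomial.eval_add]; omega
    · simp [ho', ho, eval, encodeNats_append]
  | range t o ih =>
    obtain ⟨p, hp⟩ := t.exec_compile
    obtain ⟨q, hq⟩ := ih
    obtain ⟨v, hv⟩ := t.exists_eval_le
    refine ⟨p + v * (q.comp (v + .X) + 2) + 2, fun b w vr ρ d s B hw hρ hs => ?_⟩
    obtain ⟨T, s', hE, hT, hval, hpr, ho⟩ := hp b w vr ρ d s B hw hρ hs
    have hm := hv w ρ B hw hρ
    set m := t.eval w ρ with hm_def
    have hs' := hs.preserves hpr
    obtain ⟨T', z, hE', hT', hz, hzd, hzj, hzo⟩ := Exec.loop_of_invariant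
      (e := .sub (.reg d) (.reg (d + 1)))
      (P := .seq (o.compile b (RAM.push (d + 1) vr) (d + 2))
          (.assign (d + 1) (.add (.reg (d + 1)) (.const 1))))
      (fun j z => Preserves d s' z ∧ z.reg d = m ∧ z.reg (d + 1) = j ∧
        z.out = s'.out ++ encodeNats ((List.range j).flatMap fun a => o.eval w (RAM.push a ρ)))
      (m := m) (K := q.eval (v.eval B + B) + 1)
      (by
        rintro j hj z ⟨hz, hzd, hzj, hzo⟩
        refine ⟨by simp only [Expr.eval, hzd, hzj]; omega, ?_⟩
        obtain ⟨T₁, y, hE₁, hT₁, hpy, hyo⟩ := hq b w (RAM.push (d + 1) vr) (RAM.push j ρ)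
          (d + 2) z (v.eval B + B) (by omega)
          (push_le (by omega) fun i => (hρ i).trans (by omega))
          (((hs'.preserves hz).mono (by omega)).push (by omega) hzj)
        refine ⟨_, _, hE₁.seq (Exec.assign _ _ _), by omega, ?_, ?_, ?_, ?_⟩
        · exact hz.trans ((hpy.mono (by omega)).trans (.assign (by omega) _ _))
        · simp [hpy.reg d (by omega), hzd]
        · simp [Expr.eval, hpy.reg (d + 1) (by omega), hzj]
        · simp [hyo, hzo, List.range_succ, encodeNats_append])
      (by
        rintro z ⟨-, hzd, hzj, -⟩
        simp [Expr.eval, hzd, hzj])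
      (s := { s' with reg := Function.update s'.reg (d + 1) 0 })
      ⟨.assign (by omega) _ _, by simp [hval], by simp, by simp [encodeNats]⟩
    refine ⟨_, _, hE.seq ((Exec.assign _ _ _).seq hE'), ?_, hpr.trans hz, ?_⟩
    · simp only [Polynomial.eval_add, Polynomial.eval_mul, Polynomial.eval_comp, Polynomial.eval_X,
        Polynomial.eval_ofNat]
      change T' ≤ m * (q.eval (v.eval B + B) + 2) + 1 at hT'
      have := Nat.mul_le_mul_right (q.eval (v.eval B + B) + 2) hm
      omega
    · simp [hzo, ho, eval, ← hm_def]

end RAM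

/-! ### Functions and predicates expressible by terms -/

namespace RAM

/-- Application of `g` to the free variables of a term. -/
def BTerm.rename : BTerm → (ℕ → ℕ) → BTerm
  | .var i, g => .var (g i)
  | .const a, _ => .const a
  | .len, _ => .len
  | .bit t, g => .bit (t.rename g)
  | .add t u, g => .add (t.rename g) (u.rename g)
  | .sub t u, g => .sub (t.rename g) (u.rename g)
  | .bsum t u, g => .bsum (t.rename g) (u.rename (push 0 fun i => g i + 1))

theorem BTerm.eval_rename (w : List Bool) (t : BTerm) :
    ∀ (g ρ : ℕ → ℕ), (t.rename g).eval w ρ = t.eval w fun i => ρ (g i) := by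
  induction t with
  | bsum t u iht ihu =>
    intro g ρ
    simp only [rename, eval, iht, ihu]
    refine Finset.sum_congr rfl fun a _ => congrArg _ ?_
    funext i
    cases i <;> rfl
  | _ => simp_all [rename, eval]

end RAM

open RAM

/-- Data that consist of a structure with a number and of finitely many further natural numbers,
the latter being accessible to terms as variables. -/
class TermContext (τ : outParam (List ℕ)) (α : Type) where
  inst : α → WDInstance τ
  env : α → ℕ → ℕ

instance {τ : List ℕ} : TermContext τ (WDInstance τ) := ⟨id, fun _ _ => 0⟩

instance {τ : List ℕ} {α : Type} [TermContext τ α] : TermContext τ (α × ℕ) :=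
  ⟨fun x => TermContext.inst x.1, fun x => push x.2 (TermContext.env x.1)⟩

open TermContext

/-- The function is given by a term on the encoding of the structure. Such functions are computable
in polynomial time. -/
def Expressible {τ : List ℕ} {α : Type} [TermContext τ α] (f : α → ℕ) : Prop :=
  ∃ t : BTerm, ∀ x, t.eval (inst x).encode (env x) = f x

/-- The predicate is given by a term, nonzero values meaning truth. -/
def ExpressiblePred {τ : List ℕ} {α : Type} [TermContext τ α] (p : α → Prop) : Prop :=
  ∃ f : α → ℕ, Expressible f ∧ ∀ x, f x ≠ 0 ↔ p x

/-- The list-valued function is given by a scheme on the encoding of the structure. -/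
def ExpressibleList {τ : List ℕ} {α : Type} [TermContext τ α] (f : α → List ℕ) : Prop :=
  ∃ o : BOut, ∀ x, o.eval (inst x).encode (env x) = f x

section Closure

variable {τ : List ℕ} {α : Type} [TermContext τ α] {f g : α → ℕ} {p q : α → Prop}

namespace Expressible

theorem congr (hf : Expressible f) (h : ∀ x, f x = g x) : Expressible g := by
  obtain ⟨t, ht⟩ := hf
  exact ⟨t, fun x => (ht x).trans (h x)⟩

theorem const (a : ℕ) : Expressible fun _ : α => a := ⟨.const a, fun _ => rfl⟩

theorem len : Expressible fun x : α => (inst x).encode.length := ⟨.len, fun _ => rfl⟩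

theorem snd : Expressible fun x : α × ℕ => x.2 := ⟨.var 0, fun _ => rfl⟩

theorem comp_fst (hf : Expressible f) : Expressible fun x : α × ℕ => f x.1 := by
  obtain ⟨t, ht⟩ := hf
  exact ⟨t.rename Nat.succ, fun x => (BTerm.eval_rename _ _ _ _).trans (ht x.1)⟩

theorem bit (hf : Expressible f) :
    Expressible fun x => ((inst x).encode.getD (f x) false).toNat := by
  obtain ⟨t, ht⟩ := hf
  exact ⟨.bit t, fun x => by rw [BTerm.eval, ht]⟩

theorem add (hf : Expressible f) (hg : Expressible g) : Expressible fun x => f x + g x := by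
  obtain ⟨t, ht⟩ := hf
  obtain ⟨u, hu⟩ := hg
  exact ⟨.add t u, fun x => by rw [BTerm.eval, ht, hu]⟩

theorem sub (hf : Expressible f) (hg : Expressible g) : Expressible fun x => f x - g x := by
  obtain ⟨t, ht⟩ := hf
  obtain ⟨u, hu⟩ := hg
  exact ⟨.sub t u, fun x => by rw [BTerm.eval, ht, hu]⟩

theorem sum_range {F : α → ℕ → ℕ} (hf : Expressible f)
    (hF : Expressible fun y : α × ℕ => F y.1 y.2) :
    Expressible fun x => ∑ i ∈ Finset.range (f x), F x i := by
  obtain ⟨t, ht⟩ := hf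
  obtain ⟨u, hu⟩ := hF
  refine ⟨.bsum t u, fun x => ?_⟩
  rw [BTerm.eval, ht]
  exact Finset.sum_congr rfl fun i _ => hu (x, i)

theorem mul (hf : Expressible f) (hg : Expressible g) : Expressible fun x => f x * g x :=
  (sum_range (F := fun x _ => g x) hf hg.comp_fst).congr fun x => by simp

theorem pow (hf : Expressible f) (r : ℕ) : Expressible fun x => f x ^ r := by
  induction r with
  | zero => simpa using const 1
  | succ r ih => simpa only [pow_succ] using ih.mul hf

theorem sum {ι : Type} {F : ι → α → ℕ} (S : Finset ι) (hF : ∀ i, Expressible (F i)) :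
    Expressible fun x => ∑ i ∈ S, F i x := by
  classical
  induction S using Finset.induction_on with
  | empty => simpa using const 0
  | insert i S hi ih => simpa only [Finset.sum_insert hi] using (hF i).add ih

theorem ite (hp : ExpressiblePred p) (hf : Expressible f) (hg : Expressible g)
    [∀ x, Decidable (p x)] : Expressible fun x => if p x then f x else g x := by
  obtain ⟨e, he, hep⟩ := hp
  have h : Expressible fun x => (1 - (1 - e x)) * f x + (1 - e x) * g x :=
    (((const 1).sub ((const 1).sub he)).mul hf).add (((const 1).sub he).mul hg)
  refine h.congr fun x => ?_
  rcases Nat.eq_zero_or_pos (e x) with h0 | h0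
  · rw [if_neg (by rw [← hep]; omega), h0]; simp
  · rw [if_pos (by rw [← hep]; omega), Nat.sub_eq_zero_of_le h0]; simp

end Expressible

namespace ExpressiblePred

theorem congr (hp : ExpressiblePred p) (h : ∀ x, p x ↔ q x) : ExpressiblePred q := by
  obtain ⟨f, hf, hfp⟩ := hp
  exact ⟨f, hf, fun x => (hfp x).trans (h x)⟩

theorem lt (hf : Expressible f) (hg : Expressible g) : ExpressiblePred fun x => f x < g x :=
  ⟨_, hg.sub hf, fun x => by omega⟩

theorem not (hp : ExpressiblePred p) : ExpressiblePred fun x => ¬ p x := by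
  obtain ⟨f, hf, hfp⟩ := hp
  exact ⟨_, (Expressible.const 1).sub hf, fun x => by
    beta_reduce
    rw [← hfp]
    omega⟩

theorem and (hp : ExpressiblePred p) (hq : ExpressiblePred q) :
    ExpressiblePred fun x => p x ∧ q x := by
  obtain ⟨f, hf, hfp⟩ := hp
  obtain ⟨g, hg, hgq⟩ := hq
  exact ⟨_, hf.mul hg, fun x => by
    beta_reduce
    rw [← hfp, ← hgq]
    exact mul_ne_zero_iff⟩

theorem imp (hp : ExpressiblePred p) (hq : ExpressiblePred q) :
    ExpressiblePred fun x => p x → q x :=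
  (hp.and hq.not).not.congr fun x => by tauto

theorem le (hf : Expressible f) (hg : Expressible g) : ExpressiblePred fun x => f x ≤ g x :=
  (lt hg hf).not.congr fun _ => not_lt

theorem eq (hf : Expressible f) (hg : Expressible g) : ExpressiblePred fun x => f x = g x :=
  ((le hf hg).and (le hg hf)).congr fun _ => le_antisymm_iff.symm

theorem const (P : Prop) : ExpressiblePred fun _ : α => P := by
  by_cases h : P
  · exact ⟨_, Expressible.const 1, fun _ => by simpa using h⟩
  · exact ⟨_, Expressible.const 0, fun _ => by simpa using h⟩

theorem ball {P : α → ℕ → Prop} (hf : Expressible f)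
    (hP : ExpressiblePred fun y : α × ℕ => P y.1 y.2) :
    ExpressiblePred fun x => ∀ i < f x, P x i := by
  obtain ⟨g, hg, hgP⟩ := hP.not
  refine ExpressiblePred.not ⟨_, .sum_range (F := fun x i => g (x, i)) hf hg, fun x => ?_⟩ |>.congr
    (p := fun x => ¬ ∃ i < f x, ¬ P x i) fun x => by push Not; rfl
  simpa [Finset.sum_eq_zero_iff] using exists_congr fun i => and_congr_right fun _ => hgP (x, i)

theorem forall_fintype {ι : Type} [Fintype ι] {P : ι → α → Prop}
    (hP : ∀ i, ExpressiblePred (P i)) : ExpressiblePred fun x => ∀ i, P i x := by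
  choose g hg hgP using fun i => (hP i).not
  refine ExpressiblePred.not ⟨_, .sum Finset.univ hg, fun x => ?_⟩ |>.congr
    (p := fun x => ¬ ∃ i, ¬ P i x) fun x => by push Not; rfl
  simp [Finset.sum_eq_zero_iff, ← hgP]

end ExpressiblePred

namespace Expressible

theorem div (hf : Expressible f) (hg : Expressible g) (h0 : ∀ x, 0 < g x) :
    Expressible fun x => f x / g x := by
  have h : Expressible fun x => ∑ i ∈ Finset.range (f x), if (i + 1) * g x ≤ f x then 1 else 0 :=
    sum_range (F := fun x i => if (i + 1) * g x ≤ f x then 1 else 0) hf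
      (ite (.le ((snd.add (const 1)).mul hg.comp_fst) hf.comp_fst) (const 1) (const 0))
  refine h.congr fun x => ?_
  rw [Finset.sum_boole]
  have : {i ∈ Finset.range (f x) | (i + 1) * g x ≤ f x} = Finset.range (f x / g x) := by
    ext i
    simp only [Finset.mem_filter, Finset.mem_range]
    rw [← Nat.le_div_iff_mul_le (h0 x)]
    have := Nat.div_le_self (f x) (g x)
    omega
  simp [this]

theorem mod (hf : Expressible f) (hg : Expressible g) (h0 : ∀ x, 0 < g x) :
    Expressible fun x => f x % g x :=
  (hf.sub (hg.mul (hf.div hg h0))).congr fun x => by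
    have := Nat.div_add_mod (f x) (g x)
    omega

end Expressible

namespace ExpressibleList

variable {u v : α → List ℕ}

theorem singleton (hf : Expressible f) : ExpressibleList fun x => [f x] := by
  obtain ⟨t, ht⟩ := hf
  exact ⟨.nat t, fun x => by rw [BOut.eval, ht]⟩

theorem append (hu : ExpressibleList u) (hv : ExpressibleList v) :
    ExpressibleList fun x => u x ++ v x := by
  obtain ⟨t, ht⟩ := hu
  obtain ⟨t', ht'⟩ := hv
  exact ⟨.append t t', fun x => by rw [BOut.eval, ht, ht']⟩

theorem flatMap_range {F : α → ℕ → List ℕ} (hf : Expressible f)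
    (hF : ExpressibleList fun y : α × ℕ => F y.1 y.2) :
    ExpressibleList fun x => (List.range (f x)).flatMap (F x) := by
  obtain ⟨t, ht⟩ := hf
  obtain ⟨o, ho⟩ := hF
  refine ⟨.range t o, fun x => ?_⟩
  rw [BOut.eval, ht]
  exact congrArg (fun F => List.flatMap F _) (funext fun i => ho (x, i))

end ExpressibleList

end Closure

/-! ### Decoding structures -/

/-- The number of zeros among the first `i` bits of a word. -/
def zerosBefore (w : List Bool) (i : ℕ) : ℕ :=
  ∑ j ∈ Finset.range i, (1 - (w.getD j false).toNat)

/-- The number of ones in a word that are preceded by exactly `a` zeros: this is the `a`-th number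
of an encoded list. -/
def natAt (w : List Bool) (a : ℕ) : ℕ :=
  ∑ i ∈ Finset.range w.length, if zerosBefore w i = a then (w.getD i false).toNat else 0

theorem zerosBefore_cons (b : Bool) (w : List Bool) (i : ℕ) :
    zerosBefore (b :: w) (i + 1) = zerosBefore w i + (1 - b.toNat) := by
  simp [zerosBefore, Finset.sum_range_succ']

theorem natAt_true_cons (w : List Bool) (a : ℕ) :
    natAt (true :: w) a = natAt w a + if a = 0 then 1 else 0 := by
  have h0 : zerosBefore (true :: w) 0 = 0 := by simp [zerosBefore]
  simp [natAt, Finset.sum_range_succ', zerosBefore_cons, h0, eq_comm]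

theorem natAt_false_cons_zero (w : List Bool) : natAt (false :: w) 0 = 0 := by
  simp [natAt, Finset.sum_range_succ', zerosBefore_cons]

theorem natAt_false_cons_succ (w : List Bool) (a : ℕ) :
    natAt (false :: w) (a + 1) = natAt w a := by
  simp [natAt, Finset.sum_range_succ', zerosBefore_cons]

theorem natAt_encodeNats (l : List ℕ) : ∀ a, natAt (encodeNats l) a = l.getD a 0 := by
  induction l with
  | nil => simp [natAt, encodeNats]
  | cons x l ih =>
    have key : ∀ x a, natAt (List.replicate x true ++ false :: encodeNats l) a
        = (x :: l).getD a 0 := by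
      intro x
      induction x with
      | zero =>
        intro a
        cases a with
        | zero => simpa using natAt_false_cons_zero _
        | succ a => simpa [natAt_false_cons_succ] using ih a
      | succ x ihx =>
        intro a
        rw [List.replicate_succ, List.cons_append, natAt_true_cons, ihx]
        cases a <;> simp
    intro a
    rw [← key]
    simp [encodeNats]

theorem List.getD_flatten_ofFn {r : ℕ} (F : Fin r → List ℕ) (q : Fin r) (j : ℕ)
    (hj : j < (F q).length) :
    (List.ofFn F).flatten.getD (∑ i : Fin r, (if i < q then (F i).length else 0) + j) 0
      = (F q).getD j 0 := by
  induction r with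
  | zero => exact q.elim0
  | succ r ih =>
    rw [List.ofFn_succ, List.flatten_cons, Fin.sum_univ_succ]
    refine Fin.cases ?_ (fun q hj => ?_) q hj
    · intro hj
      simpa using List.getD_append _ _ _ _ hj
    · simp only [Fin.succ_pos, if_true, Fin.succ_lt_succ_iff]
      rw [List.getD_append_right _ _ _ _ (by omega), ← ih (fun i => F i.succ) q hj]
      congr 1
      omega

theorem WDInstance.rel_eq_true_iff {τ : List ℕ} (x : WDInstance τ) (q : Fin τ.length)
    (v : Fin (τ.get q) → Fin x.n) :
    x.rel q v = true ↔ natAt x.encode (∑ i : Fin τ.length, (if i < q then x.n ^ τ.get i else 0)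
      + ∑ i, (v i : ℕ) * x.n ^ (i : ℕ) + 2) = 1 := by
  rw [WDInstance.encode, natAt_encodeNats, List.getD_cons_succ, List.getD_cons_succ]
  have h := List.getD_flatten_ofFn (fun q : Fin τ.length => List.ofFn fun j : Fin (x.n ^ τ.get q) =>
    (x.rel q (finFunctionFinEquiv.symm j)).toNat) q (finFunctionFinEquiv v)
    (by simp only [List.length_ofFn]; exact Fin.is_lt _)
  simp only [List.length_ofFn] at h
  rw [← finFunctionFinEquiv_apply, h, List.getD_eq_getElem _ _
    (by simp only [List.length_ofFn]; exact Fin.is_lt _), List.getElem_ofFn,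
    Fin.eta, Equiv.symm_apply_apply, Bool.toNat_eq_one]

section Decoding

variable {τ : List ℕ} {α : Type} [TermContext τ α] {f : α → ℕ}

namespace Expressible

theorem natAt (hf : Expressible f) : Expressible fun x => natAt (inst x).encode (f x) :=
  sum_range (F := fun x i => if zerosBefore (inst x).encode i = f x then
      ((inst x).encode.getD i false).toNat else 0) len
    (ite (.eq (sum_range (F := fun (x : α × ℕ) j => 1 - ((inst x).encode.getD j false).toNat) snd
      ((const 1).sub (bit snd))) hf.comp_fst) (bit snd) (const 0))

theorem univ : Expressible fun x : α => (inst x).n :=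
  (natAt (const 0)).congr fun x => by rw [WDInstance.encode, natAt_encodeNats]; rfl

theorem weight : Expressible fun x : α => (inst x).k :=
  (natAt (const 1)).congr fun x => by rw [WDInstance.encode, natAt_encodeNats]; rfl

end Expressible

theorem ExpressiblePred.rel (q : Fin τ.length) {v : ∀ x : α, Fin (τ.get q) → Fin (inst x).n}
    (hv : ∀ i, Expressible fun x => (v x i : ℕ)) :
    ExpressiblePred fun x => (inst x).rel q (v x) = true :=
  (ExpressiblePred.eq (.natAt (((Expressible.sum Finset.univ fun i : Fin τ.length =>
      Expressible.ite (.const (i < q)) (Expressible.univ.pow (τ.get i)) (.const 0)).add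
      (.sum Finset.univ fun i => (hv i).mul (Expressible.univ.pow i))).add (.const 2)))
    (.const 1)).congr fun x => ((inst x).rel_eq_true_iff q (v x)).symm

end Decoding

/-! ### Permutations defined by sorting keys -/

/-- The number of elements of `Fin n` with a smaller key. -/
def keyRank {n : ℕ} (key : ℕ → ℕ) (w : Fin n) : Fin n :=
  ⟨(Finset.univ.filter fun v : Fin n => key v < key w).card, by
    have h : (Finset.univ.filter fun v : Fin n => key v < key w).card < Finset.univ.card :=
      Finset.card_lt_card (Finset.filter_ssubset.2 ⟨w, Finset.mem_univ w, lt_irrefl (key w)⟩)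
    simpa using h⟩

theorem keyRank_lt_iff {n : ℕ} (key : ℕ → ℕ) (u w : Fin n) :
    keyRank key u < keyRank key w ↔ key u < key w := by
  constructor
  · intro h
    by_contra hle
    refine absurd h (not_lt.2 (Fin.mk_le_mk.2 (Finset.card_le_card fun v hv => ?_)))
    simp only [Finset.mem_filter, Finset.mem_univ, true_and] at hv ⊢
    omega
  · intro h
    refine Fin.mk_lt_mk.2
      (Finset.card_lt_card ((Finset.ssubset_iff_of_subset fun v hv => ?_).2 ⟨u, ?_, ?_⟩))
    · simp only [Finset.mem_filter, Finset.mem_univ, true_and] at hv ⊢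
      omega
    · simpa using h
    · simp

theorem keyRank_bijective {n : ℕ} {key : ℕ → ℕ} (hkey : Set.InjOn key (Set.Iio n)) :
    Function.Bijective (keyRank key : Fin n → Fin n) := by
  refine Finite.injective_iff_bijective.1 fun u w h => Fin.ext (hkey u.2 w.2 ?_)
  have h₁ := (keyRank_lt_iff key u w).not.1 h.not_lt
  have h₂ := (keyRank_lt_iff key w u).not.1 h.symm.not_lt
  omega

/-- The permutation whose word lists the elements of `Fin n` in the order of their keys. -/
noncomputable def permOfKey {n : ℕ} (key : ℕ → ℕ) (hkey : Set.InjOn key (Set.Iio n)) :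
    Equiv.Perm (Fin n) :=
  (Equiv.ofBijective _ (keyRank_bijective hkey)).symm

theorem permOfKey_symm_lt_iff {n : ℕ} {key : ℕ → ℕ} (hkey : Set.InjOn key (Set.Iio n))
    (u w : Fin n) :
    (permOfKey key hkey).symm u < (permOfKey key hkey).symm w ↔ key u < key w :=
  keyRank_lt_iff key u w

theorem permOfKey_apply {n : ℕ} {key : ℕ → ℕ} (hkey : Set.InjOn key (Set.Iio n)) (j : Fin n) :
    (permOfKey key hkey j : ℕ) = ∑ w ∈ Finset.range n,
      if ∑ v ∈ Finset.range n, (if key v < key w then 1 else 0) = (j : ℕ) then w else 0 := by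
  have hr : ∀ w : Fin n, ∑ v ∈ Finset.range n, (if key v < key w then 1 else 0)
      = (keyRank key w : ℕ) := by
    intro w
    rw [← Fin.sum_univ_eq_sum_range (fun v => if key v < key w then 1 else 0), Finset.sum_boole]
    rfl
  rw [← Fin.sum_univ_eq_sum_range
    (fun w => if ∑ v ∈ Finset.range n, (if key v < key w then 1 else 0) = (j : ℕ) then w else 0)]
  have hj : keyRank key (permOfKey key hkey j) = j :=
    (permOfKey key hkey).symm_apply_apply j
  rw [Finset.sum_eq_single (permOfKey key hkey j)]
  · rw [hr, hj, if_pos rfl]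
  · intro w _ hw
    rw [hr, if_neg]
    rw [Fin.val_inj]
    exact fun h => hw ((keyRank_bijective hkey).1 (h.trans hj.symm))
  · simp

/-! ### From cliques to common subsequences -/

/-- The element sets of common subsequences are the nonempty sets on which the two permutations
induce the same order. -/
theorem exists_commonSubseq_iff {n : ℕ} (σs σt : Equiv.Perm (Fin n)) (B : Finset (Fin n)) :
    (∃ b ∈ commonSubseq σs σt, b.toFinset = B) ↔
      B.Nonempty ∧ ∀ u ∈ B, ∀ w ∈ B, σs.symm u < σs.symm w → σt.symm u < σt.symm w := by
  constructor
  · rintro ⟨b, ⟨hb, -, hp⟩, rfl⟩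
    refine ⟨?_, fun u hu w hw h => ?_⟩
    · rw [List.toFinset_nonempty_iff]
      exact List.ne_nil_of_length_pos hb
    · rw [List.mem_toFinset] at hu hw
      obtain ⟨i, hi, rfl⟩ := List.getElem_of_mem hu
      obtain ⟨j, hj, rfl⟩ := List.getElem_of_mem hw
      rw [List.pairwise_iff_getElem] at hp
      rcases lt_trichotomy i j with hij | rfl | hij
      · exact (hp i j hi hj hij).2
      · exact absurd h (lt_irrefl _)
      · exact absurd h (hp j i hj hi hij).1.asymm
  · rintro ⟨hne, hB⟩
    let b := ((List.finRange n).map σs).filter (· ∈ B)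
    have hb : b.toFinset = B := by
      ext u
      simp only [b, List.mem_toFinset, List.mem_filter, List.mem_map, List.mem_finRange, true_and,
        decide_eq_true_eq, and_iff_right_iff_imp]
      exact fun _ => ⟨σs.symm u, σs.apply_symm_apply u⟩
    have hp : b.Pairwise fun u v => σs.symm u < σs.symm v := by
      refine List.Pairwise.filter _ (List.pairwise_map.2 ?_)
      simpa using List.pairwise_lt_finRange n
    refine ⟨b, ⟨?_, ?_, ?_⟩, hb⟩
    · rw [Nat.one_le_iff_ne_zero, Ne, List.length_eq_zero_iff, ← List.toFinset_eq_empty_iff, hb]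
      exact hne.ne_empty
    · calc b.length ≤ ((List.finRange n).map σs).length := List.length_filter_le _ _
        _ = n := by simp
    · refine hp.imp_of_mem fun {u v} hu hv h => ⟨h, hB u ?_ v ?_ h⟩ <;>
        rw [← hb, List.mem_toFinset] <;> assumption

section Star

open scoped Classical in
/-- Sorting key for the order: first `u`, then the elements below `V` that are not compatible with
`u`, then all others. -/
noncomputable def starKeyFst (V M : ℕ) (compat : ℕ → ℕ → Prop) (u w : ℕ) : ℕ :=
  if w = u then 0 else if w < V ∧ ¬ compat u w then M + w else 3 * M + w

open scoped Classical in
/-- Sorting key for the order: first the elements from `V` on, descending, then the elements below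
`V` that are not compatible with `u`, then `u`, then all others. -/
noncomputable def starKeySnd (V M : ℕ) (compat : ℕ → ℕ → Prop) (u w : ℕ) : ℕ :=
  if V ≤ w then M - w else if w = u then 2 * M else if ¬ compat u w then M + w else 3 * M + w

variable (V c l : ℕ) (compat : ℕ → ℕ → Prop)

theorem starKeyFst_injOn (M u : ℕ) : Set.InjOn (starKeyFst V M compat u) (Set.Iio M) := by
  intro v hv w hw h
  simp only [Set.mem_Iio] at hv hw
  unfold starKeyFst at h
  split_ifs at h <;> omega

theorem starKeySnd_injOn (M u : ℕ) : Set.InjOn (starKeySnd V M compat u) (Set.Iio M) := by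
  intro v hv w hw h
  simp only [Set.mem_Iio] at hv hw
  unfold starKeySnd at h
  split_ifs at h <;> omega

/-- The instance with elements `0, …, V ^ c - 1`, of which only those below `V` are useful, and with
one pair of permutations for every `u < V`. Among the elements below `V`, the two permutations of
this pair disagree exactly on the order of `u` and the elements not compatible with `u`. -/
noncomputable def starInstance : LFSDInstance where
  n := V ^ c
  k := V
  Γs u := permOfKey (starKeyFst V (V ^ c) compat u) (starKeyFst_injOn V compat _ u)
  Γt u := permOfKey (starKeySnd V (V ^ c) compat u) (starKeySnd_injOn V compat _ u)
  l := l

variable {V c l compat}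

/-- On a set of elements below `V`, the two orders for `u` agree as soon as `u`, if it belongs to
the set, is compatible with all its other elements. -/
theorem starKeySnd_lt_of_starKeyFst_lt {M u v w : ℕ} (hv : v < V) (hw : w < V) (hVM : V ≤ M)
    (huv : w = u → v ≠ u → compat u v) (huw : v = u → w ≠ u → compat u w)
    (h : starKeyFst V M compat u v < starKeyFst V M compat u w) :
    starKeySnd V M compat u v < starKeySnd V M compat u w := by
  unfold starKeyFst at h
  unfold starKeySnd
  rw [if_neg (not_le.2 hv), if_neg (not_le.2 hw)]
  by_cases h₁ : v = u <;> by_cases h₂ : w = u <;> by_cases h₃ : compat u v <;>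
    by_cases h₄ : compat u w <;> simp_all <;> omega

/-- An element from `V` on cannot occur together with any other element. -/
theorem lt_of_starKey {M u v w : ℕ} (hu : u < V) (hw : w < M) (hv : v < M)
    (hvw : v ≠ w) (h₁ : starKeyFst V M compat u v < starKeyFst V M compat u w →
      starKeySnd V M compat u v < starKeySnd V M compat u w)
    (h₂ : starKeyFst V M compat u w < starKeyFst V M compat u v →
      starKeySnd V M compat u w < starKeySnd V M compat u v) : w < V := by
  by_contra hwV
  have e₁ : starKeyFst V M compat u w = 3 * M + w := by
    rw [starKeyFst, if_neg (by omega), if_neg fun h => hwV h.1]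
  have e₂ : starKeySnd V M compat u w = M - w := by rw [starKeySnd, if_pos (not_lt.1 hwV)]
  rw [e₁, e₂] at h₁ h₂
  unfold starKeyFst starKeySnd at h₁ h₂
  split_ifs at h₁ h₂ <;> omega

theorem compat_of_starKey {M u w : ℕ} (hu : u < V) (hw : w < V) (hVM : V ≤ M) (huw : u ≠ w)
    (h : starKeyFst V M compat u u < starKeyFst V M compat u w →
      starKeySnd V M compat u u < starKeySnd V M compat u w) : compat u w := by
  by_contra hc
  have e₁ : starKeyFst V M compat u u = 0 := if_pos rfl
  have e₂ : starKeyFst V M compat u w = M + w := by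
    rw [starKeyFst, if_neg huw.symm, if_pos ⟨hw, hc⟩]
  have e₃ : starKeySnd V M compat u u = 2 * M := by
    rw [starKeySnd, if_neg (not_le.2 hu), if_pos rfl]
  have e₄ : starKeySnd V M compat u w = M + w := by
    rw [starKeySnd, if_neg (not_le.2 hw), if_neg huw.symm, if_pos hc]
  omega

theorem exists_isFeasible_starInstance_iff (hV : 0 < V) (hc : 1 ≤ c) (hl : 2 ≤ l) :
    (∃ B : Finset (Fin (starInstance V c l compat).n), B.card = l ∧
      IsFeasible (starInstance V c l compat).Γs (starInstance V c l compat).Γt B) ↔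
    ∃ B : Finset ℕ, (∀ u ∈ B, u < V) ∧ B.card = l ∧
      ∀ u ∈ B, ∀ w ∈ B, u ≠ w → compat u w := by
  have hVM : V ≤ V ^ c := Nat.le_self_pow (by omega) V
  have key : ∀ B : Finset (Fin (V ^ c)),
      IsFeasible (starInstance V c l compat).Γs (starInstance V c l compat).Γt B ↔
        ∀ u : Fin V, B.Nonempty ∧ ∀ v ∈ B, ∀ w ∈ B,
          starKeyFst V (V ^ c) compat u v < starKeyFst V (V ^ c) compat u w →
            starKeySnd V (V ^ c) compat u v < starKeySnd V (V ^ c) compat u w := by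
    intro B
    refine forall_congr' fun u =>
      (exists_commonSubseq_iff _ _ B).trans (and_congr_right fun _ => ?_)
    simp only [starInstance, permOfKey_symm_lt_iff]
  change (∃ B : Finset (Fin (V ^ c)), B.card = l ∧ IsFeasible (n := V ^ c) (k := V) _ _ B) ↔ _
  constructor
  · rintro ⟨B, hB, hf⟩
    replace hf := (key B).1 hf
    have hlt : ∀ w ∈ B, (w : ℕ) < V := by
      intro w hw
      obtain ⟨v, hv, hvw⟩ := Finset.exists_mem_ne (by omega : 1 < B.card) w
      exact lt_of_starKey hV w.2 v.2 (fun h => hvw (Fin.ext h))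
        ((hf ⟨0, hV⟩).2 v hv w hw) ((hf ⟨0, hV⟩).2 w hw v hv)
    refine ⟨B.map Fin.valEmbedding, ?_, by simpa using hB, ?_⟩
    · simpa [Finset.mem_map] using hlt
    · simp only [Finset.mem_map, Fin.valEmbedding_apply]
      rintro _ ⟨u, hu, rfl⟩ _ ⟨w, hw, rfl⟩ huw
      exact compat_of_starKey (hlt u hu) (hlt w hw) hVM huw ((hf ⟨u, hlt u hu⟩).2 u hu w hw)
  · rintro ⟨B, hlt, hB, hcl⟩
    refine ⟨B.attachFin (n := V ^ c) fun u hu => (hlt u hu).trans_le hVM, by simpa using hB, ?_⟩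
    refine (key _).2 fun u => ⟨?_, fun v hv w hw => ?_⟩
    · rw [← Finset.card_pos, Finset.card_attachFin]
      omega
    · rw [Finset.mem_attachFin] at hv hw
      refine starKeySnd_lt_of_starKeyFst_lt (hlt _ hv) (hlt _ hw) hVM (fun h h' => ?_)
        fun h h' => ?_
      · exact hcl _ (h ▸ hw) _ hv h'.symm
      · exact hcl _ (h ▸ hv) _ hw h'.symm

end Star

/-! ### Weighted definability and increasing sequences -/

/-- Satisfaction of a quantifier-free formula, where `mem v` is the truth value of the atomic
formula `X (x_{v 0}, x_{v 1}, …)`. -/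
def QFree.HoldsWith {τ : List ℕ} {s m : ℕ} (x : WDInstance τ) (mem : (Fin s → Fin m) → Prop)
    (a : Fin m → Fin x.n) : QFree τ s m → Prop
  | .eq i j => a i = a j
  | .rel q v => x.rel q (fun i => a (v i)) = true
  | .X v => mem v
  | .neg φ => ¬ φ.HoldsWith x mem a
  | .and φ ψ => φ.HoldsWith x mem a ∧ ψ.HoldsWith x mem a

theorem QFree.holds_iff_holdsWith {τ : List ℕ} {s m : ℕ} (x : WDInstance τ)
    (S : Finset (Fin s → Fin x.n)) (a : Fin m → Fin x.n) (ψ : QFree τ s m) :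
    ψ.Holds x S a ↔ ψ.HoldsWith x (fun v => (fun i => a (v i)) ∈ S) a := by
  induction ψ with
  | neg φ ih => simp only [Holds, HoldsWith, ih]
  | and φ ψ ihφ ihψ => simp only [Holds, HoldsWith, ihφ, ihψ]
  | _ => rfl

/-- The number of a tuple, counting from `1`, in the order of the values as base-`n` numerals. -/
def tupleNum {n s : ℕ} (t : Fin s → Fin n) : ℕ := (finFunctionFinEquiv t : ℕ) + 1

theorem tupleNum_pos {n s : ℕ} (t : Fin s → Fin n) : 0 < tupleNum t := Nat.succ_pos _

theorem tupleNum_le {n s : ℕ} (t : Fin s → Fin n) : tupleNum t ≤ n ^ s :=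
  (finFunctionFinEquiv t).is_lt

theorem tupleNum_injective {n s : ℕ} :
    Function.Injective (tupleNum : (Fin s → Fin n) → ℕ) := fun _ _ h =>
  finFunctionFinEquiv.injective (Fin.ext (Nat.succ_injective h))

theorem exists_tupleNum_eq {n s t : ℕ} (h₀ : 0 < t) (ht : t ≤ n ^ s) :
    ∃ v : Fin s → Fin n, tupleNum v = t :=
  ⟨finFunctionFinEquiv.symm ⟨t - 1, by omega⟩, by
    rw [tupleNum, Equiv.apply_symm_apply]
    exact Nat.sub_add_cancel h₀⟩

namespace WDInstance

variable {τ : List ℕ} {s m : ℕ} (x : WDInstance τ) (ψ : QFree τ s m)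

/-- The sequence `0 = L 0 < L 1 < ⋯ < L (k + 1) = n ^ s + 1`, in which `L 1, …, L k` are the numbers
of the elements of `S`, shows that `x` is a yes-instance. The terms from `L (k + 2)` on are
irrelevant; fixing the first of them gives the block that starts with `L (k + 1)` an end. -/
structure IsSolution (L : ℕ → ℕ) : Prop where
  strictMono : StrictMono L
  zero : L 0 = 0
  last : L (x.k + 1) = x.n ^ s + 1
  next : L (x.k + 2) = x.n ^ s + 2
  holds : ∀ a : Fin m → Fin x.n,
    ψ.HoldsWith x (fun v => ∃ j ≤ x.k, L j = tupleNum fun i => a (v i)) a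

theorem exists_isSolution_iff :
    (∃ L, x.IsSolution ψ L) ↔
      ∃ S : Finset (Fin s → Fin x.n), S.card = x.k ∧ ∀ a : Fin m → Fin x.n, ψ.Holds x S a := by
  classical
  constructor
  · rintro ⟨L, hL⟩
    let S : Finset (Fin s → Fin x.n) := Finset.univ.filter fun t => ∃ j ≤ x.k, L j = tupleNum t
    have hS : S.image tupleNum = (Finset.Icc 1 x.k).image L := by
      ext t
      simp only [S, Finset.mem_image, Finset.mem_filter, Finset.mem_univ, true_and, Finset.mem_Icc]
      constructor
      · rintro ⟨v, ⟨j, hj, hv⟩, rfl⟩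
        refine ⟨j, ⟨Nat.one_le_iff_ne_zero.2 ?_, hj⟩, hv⟩
        rintro rfl
        have := tupleNum_pos v
        rw [← hv, hL.zero] at this
        omega
      · rintro ⟨j, ⟨hj₁, hj⟩, rfl⟩
        have h₁ := hL.strictMono (by omega : 0 < j)
        have h₂ := hL.strictMono (by omega : j < x.k + 1)
        rw [hL.zero] at h₁
        rw [hL.last] at h₂
        obtain ⟨v, hv⟩ := exists_tupleNum_eq (n := x.n) (s := s) h₁ (by omega)
        exact ⟨v, ⟨j, hj, hv.symm⟩, hv⟩
    refine ⟨S, ?_, fun a => ?_⟩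
    · rw [← Finset.card_image_of_injective S tupleNum_injective, hS,
        Finset.card_image_of_injective _ hL.strictMono.injective, Nat.card_Icc]
      omega
    · rw [QFree.holds_iff_holdsWith]
      convert hL.holds a using 2
      simp [S]
  · rintro ⟨S, hS, h⟩
    -- The sequence enumerates `0`, the numbers of the elements of `S`, and all `t > n ^ s`.
    let p : ℕ → Prop := fun t => t = 0 ∨ t ∈ S.image tupleNum ∨ x.n ^ s < t
    have hinf : {t | p t}.Infinite :=
      (Set.Ioi_infinite (x.n ^ s)).mono fun t ht => Or.inr (Or.inr ht)
    have hcount : Nat.count p (x.n ^ s + 1) = x.k + 1 := by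
      have : (Finset.range (x.n ^ s + 1)).filter p = insert 0 (S.image tupleNum) := by
        ext t
        simp only [p, Finset.mem_filter, Finset.mem_range, Finset.mem_insert, Finset.mem_image]
        constructor
        · rintro ⟨h₁, h₂ | h₂ | h₂⟩
          · exact Or.inl h₂
          · exact Or.inr h₂
          · omega
        · rintro (rfl | ⟨v, hv, rfl⟩)
          · exact ⟨Nat.succ_pos _, Or.inl rfl⟩
          · exact ⟨Nat.lt_succ_of_le (tupleNum_le v), Or.inr (Or.inl ⟨v, hv, rfl⟩)⟩
      rw [Nat.count_eq_card_filter_range, this, Finset.card_insert_of_notMem,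
        Finset.card_image_of_injective _ tupleNum_injective, hS]
      simp only [Finset.mem_image, not_exists, not_and]
      exact fun v _ => (tupleNum_pos v).ne'
    have hp : ∀ t, x.n ^ s < t → p t := fun t ht => Or.inr (Or.inr ht)
    have hmono := Nat.nth_strictMono hinf
    have hlast : Nat.nth p (x.k + 1) = x.n ^ s + 1 := by
      rw [← hcount, Nat.nth_count (hp _ (by omega))]
    refine ⟨Nat.nth p, hmono, ?_, hlast, ?_, fun a => ?_⟩
    · have := Nat.nth_count (p := p) (n := 0) (Or.inl rfl)
      rwa [Nat.count_zero] at this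
    · have := Nat.nth_count (hp (x.n ^ s + 1 + 1) (by omega))
      rwa [Nat.count_succ, hcount, if_pos (hp _ (by omega))] at this
    · have ha := (QFree.holds_iff_holdsWith x S a ψ).1 (h a)
      convert ha using 2 with v
      set t : Fin s → Fin x.n := fun i => a (v i)
      constructor
      · rintro ⟨j, -, hj⟩
        have hpj : p (Nat.nth p j) := Nat.nth_mem_of_infinite hinf j
        rw [hj] at hpj
        rcases hpj with h₀ | h₀ | h₀
        · exact absurd h₀ (tupleNum_pos t).ne'
        · obtain ⟨t', ht', heq⟩ := Finset.mem_image.1 h₀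
          rwa [← tupleNum_injective heq]
        · exact absurd (tupleNum_le t) (not_le.2 h₀)
      · intro ht
        have hpt : p (tupleNum t) := Or.inr (Or.inl (Finset.mem_image_of_mem _ ht))
        refine ⟨_, Nat.lt_succ_iff.1 (hmono.lt_iff_lt.1 ?_), Nat.nth_count hpt⟩
        rw [Nat.nth_count hpt, Nat.succ_eq_add_one, hlast]
        exact Nat.lt_succ_of_le (tupleNum_le t)

end WDInstance

/-! ### Weighted definability and cliques -/

/-- The `i`-th digit of a numeral in base `A`. -/
def digit (A u i : ℕ) : ℕ := u / A ^ i % A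

/-- A block `(j, lo, hi)` as a number, where `lo, hi < D`. -/
def mkBlock (D j lo hi : ℕ) : ℕ := (j * D + lo) * D + hi

/-- The index of a block. -/
def blockIdx (D b : ℕ) : ℕ := b / (D * D)

/-- The first number of a block. -/
def blockLo (D b : ℕ) : ℕ := b / D % D

/-- The first number after a block. -/
def blockHi (D b : ℕ) : ℕ := b % D

section Block

variable {D j lo hi : ℕ}

theorem mkBlock_div (hhi : hi < D) : mkBlock D j lo hi / D = j * D + lo := by
  rw [mkBlock, Nat.mul_comm, Nat.mul_add_div (by omega), Nat.div_eq_of_lt hhi, Nat.add_zero]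

theorem blockHi_mkBlock (hhi : hi < D) : blockHi D (mkBlock D j lo hi) = hi := by
  rw [blockHi, mkBlock, Nat.mul_add_mod', Nat.mod_eq_of_lt hhi]

theorem blockLo_mkBlock (hlo : lo < D) (hhi : hi < D) : blockLo D (mkBlock D j lo hi) = lo := by
  rw [blockLo, mkBlock_div hhi, Nat.mul_add_mod', Nat.mod_eq_of_lt hlo]

theorem blockIdx_mkBlock (hlo : lo < D) (hhi : hi < D) : blockIdx D (mkBlock D j lo hi) = j := by
  rw [blockIdx, ← Nat.div_div_eq_div_mul, mkBlock_div hhi, Nat.mul_comm, Nat.mul_add_div (by omega),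
    Nat.div_eq_of_lt hlo, Nat.add_zero]

theorem mkBlock_lt {k : ℕ} (hj : j < k) (hlo : lo < D) (hhi : hi < D) :
    mkBlock D j lo hi < k * (D * D) := by
  have h₁ : j * D + lo < k * D := by
    calc j * D + lo < j * D + D := by omega
      _ = (j + 1) * D := by ring
      _ ≤ k * D := Nat.mul_le_mul_right _ hj
  calc (j * D + lo) * D + hi < (j * D + lo) * D + D := by omega
    _ = (j * D + lo + 1) * D := by ring
    _ ≤ k * D * D := Nat.mul_le_mul_right _ h₁
    _ = k * (D * D) := by ring

end Block

theorem digit_finFunctionFinEquiv {A r : ℕ} (g : Fin r → Fin A) (i : Fin r) :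
    digit A (finFunctionFinEquiv g) i = g i := by
  have h := congrFun (finFunctionFinEquiv.symm_apply_apply g) i
  rw [← h]
  simp [finFunctionFinEquiv, digit]

theorem eq_of_digit_eq {A r u w : ℕ} (hu : u < A ^ r) (hw : w < A ^ r)
    (h : ∀ i < r, digit A u i = digit A w i) : u = w := by
  have : finFunctionFinEquiv.symm (⟨u, hu⟩ : Fin (A ^ r)) = finFunctionFinEquiv.symm ⟨w, hw⟩ := by
    funext i
    refine Fin.ext ?_
    simpa [finFunctionFinEquiv, digit] using h i i.2
  simpa using this

theorem exists_mem_Ico_succ {L : ℕ → ℕ} {t : ℕ} (h0 : L 0 ≤ t) :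
    ∀ {k : ℕ}, t < L (k + 1) → ∃ j ≤ k, L j ≤ t ∧ t < L (j + 1)
  | 0, h => ⟨0, le_rfl, h0, h⟩
  | k + 1, h => by
    by_cases hk : t < L (k + 1)
    · obtain ⟨j, hj, h'⟩ := exists_mem_Ico_succ h0 hk
      exact ⟨j, hj.trans k.le_succ, h'⟩
    · exact ⟨k + 1, le_rfl, not_lt.1 hk, h⟩

namespace WDInstance

variable {τ : List ℕ} {s m : ℕ} (x : WDInstance τ) (ψ : QFree τ s m)

/-- Bound for the first number of a block and the first number after it. -/
def blockBase (s : ℕ) : ℕ := x.n ^ s + 3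

/-- The number of codes of blocks. -/
def numBlocks (s : ℕ) : ℕ := (x.k + 2) * (x.blockBase s * x.blockBase s)

/-- The assignment whose values are the base-`n` digits of `e`. -/
def assignment (m e : ℕ) : Fin m → Fin x.n :=
  fun p => ⟨e / x.n ^ (p : ℕ) % x.n, Nat.mod_lt _ x.n_pos⟩

theorem exists_assignment_eq (a : Fin m → Fin x.n) : ∃ e < x.n ^ m, x.assignment m e = a := by
  refine ⟨finFunctionFinEquiv a, Fin.is_lt _, ?_⟩
  funext p
  exact Fin.ext (digit_finFunctionFinEquiv a p)

/-- Two blocks can occur in one sequence: they have different indices or are equal, and if they are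
consecutive, then the second one starts where the first one ends. -/
def BlockCompat (s b b' : ℕ) : Prop :=
  (blockIdx (x.blockBase s) b = blockIdx (x.blockBase s) b' → b = b') ∧
  (blockIdx (x.blockBase s) b' = blockIdx (x.blockBase s) b + 1 →
    blockHi (x.blockBase s) b = blockLo (x.blockBase s) b')

/-- A block is nonempty, and starts at `0` if it is the first one and at `n ^ s + 1` if it is the
last one. -/
def BlockValid (s b : ℕ) : Prop :=
  blockLo (x.blockBase s) b < blockHi (x.blockBase s) b ∧
  (blockIdx (x.blockBase s) b = 0 → blockLo (x.blockBase s) b = 0) ∧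
  (blockIdx (x.blockBase s) b = x.k + 1 → blockLo (x.blockBase s) b = x.n ^ s + 1)

/-- The number of blocks in a vertex: one for every possible atomic formula `X (…)`, and an
additional one, by which there is a block even if `m ^ s = 0`. -/
def numDigits (s m : ℕ) : ℕ := m ^ s + 1

/-- The `i`-th block of a vertex. -/
def block (s u i : ℕ) : ℕ := digit (x.numBlocks s) u i

/-- The block of a vertex that is reserved for the atomic formula `X (x_{v 0}, x_{v 1}, …)`. -/
def atomBlock (u : ℕ) (v : Fin s → Fin m) : ℕ := x.block s u (finFunctionFinEquiv v : ℕ)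

/-- All blocks of the two vertices are compatible. -/
def DigitsCompat (s m u w : ℕ) : Prop :=
  ∀ i < numDigits s m, ∀ i' < numDigits s m, x.BlockCompat s (x.block s u i) (x.block s w i')

/-- The formula holds for every assignment for which each of the tuples occurring in an atomic
formula `X (…)` lies in the block reserved for that atomic formula; such a tuple belongs to the
relation if and only if it is the first element of the block. -/
def FormulaCheck (u : ℕ) : Prop :=
  ∀ e < x.n ^ m,
    (∀ v : Fin s → Fin m,
      blockLo (x.blockBase s) (x.atomBlock u v) ≤ tupleNum (fun i => x.assignment m e (v i)) ∧
      tupleNum (fun i => x.assignment m e (v i)) < blockHi (x.blockBase s) (x.atomBlock u v)) →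
    ψ.HoldsWith x (fun v => blockLo (x.blockBase s) (x.atomBlock u v)
      = tupleNum fun i => x.assignment m e (v i)) (x.assignment m e)

/-- A vertex is part of a description of a solution. -/
def VertexValid (u : ℕ) : Prop :=
  (∀ i < numDigits s m, x.BlockValid s (x.block s u i)) ∧ x.DigitsCompat s m u u ∧
    x.FormulaCheck ψ u

/-- The edge relation of the graph in which cliques are sought. It is not symmetric, but in a clique
it holds in both directions. -/
def VertexCompat (u w : ℕ) : Prop := x.VertexValid ψ u ∧ x.DigitsCompat s m u w

/-- The number of vertices of the graph. -/
def numVertices (s m : ℕ) : ℕ := x.numBlocks s ^ numDigits s m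

/-- The size of the cliques sought: one vertex for every sequence of indices of blocks. -/
def cliqueSize (s m : ℕ) : ℕ := (x.k + 2) ^ numDigits s m

theorem numBlocks_pos : 0 < x.numBlocks s := by
  have : 0 < x.blockBase s := Nat.succ_pos _
  unfold numBlocks
  positivity

theorem numVertices_pos : 0 < x.numVertices s m := pow_pos x.numBlocks_pos _

theorem two_le_cliqueSize : 2 ≤ x.cliqueSize s m :=
  (Nat.le_add_left 2 _).trans (Nat.le_self_pow (Nat.succ_ne_zero _) _)

theorem block_lt (u i : ℕ) : x.block s u i < x.numBlocks s := Nat.mod_lt _ x.numBlocks_pos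

theorem blockIdx_block_lt (u i : ℕ) : blockIdx (x.blockBase s) (x.block s u i) < x.k + 2 :=
  Nat.div_lt_of_lt_mul ((x.block_lt u i).trans_eq (Nat.mul_comm _ _))

/-- A solution yields a clique: the vertices are all sequences of blocks `[L j, L (j + 1))`. -/
theorem IsSolution.exists_clique {L : ℕ → ℕ} (hL : x.IsSolution ψ L) :
    ∃ B : Finset ℕ, (∀ u ∈ B, u < x.numVertices s m) ∧ B.card = x.cliqueSize s m ∧
      ∀ u ∈ B, ∀ w ∈ B, u ≠ w → x.VertexCompat ψ u w := by
  classical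
  set D := x.blockBase s with hD
  have hlt : ∀ j ≤ x.k + 2, L j < D := fun j hj => by
    have := hL.strictMono.monotone hj
    rw [hL.next] at this
    rw [hD, blockBase]
    omega
  let β : Fin (x.k + 2) → Fin (x.numBlocks s) := fun j =>
    ⟨mkBlock D j (L j) (L (j + 1)), mkBlock_lt j.2 (hlt _ (by omega)) (hlt _ (by omega))⟩
  have hidx : ∀ j, blockIdx D (β j) = j := fun j =>
    blockIdx_mkBlock (hlt _ (by omega)) (hlt _ (by omega))
  have hlo : ∀ j, blockLo D (β j) = L j := fun j =>
    blockLo_mkBlock (hlt _ (by omega)) (hlt _ (by omega))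
  have hhi : ∀ j, blockHi D (β j) = L (j + 1) := fun j => blockHi_mkBlock (hlt _ (by omega))
  let vertex : (Fin (numDigits s m) → Fin (x.k + 2)) → ℕ := fun J =>
    (finFunctionFinEquiv fun i => β (J i) : Fin (x.numBlocks s ^ numDigits s m))
  have hblock : ∀ J (i : Fin (numDigits s m)), x.block s (vertex J) i = β (J i) := fun J i =>
    digit_finFunctionFinEquiv (fun i => β (J i)) i
  have hatom : ∀ J (v : Fin s → Fin m), ∃ j, x.atomBlock (vertex J) v = β j := fun J v =>
    ⟨_, hblock J ⟨finFunctionFinEquiv v, Nat.lt_succ_of_lt (Fin.is_lt _)⟩⟩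
  have hinj : Function.Injective vertex := by
    intro J J' h
    funext i
    have := hblock J i
    rw [h, hblock] at this
    have := congrArg (blockIdx D) this
    rw [hidx, hidx] at this
    exact (Fin.ext this).symm
  have hdig : ∀ J J', x.DigitsCompat s m (vertex J) (vertex J') := by
    intro J J' i hi i' hi'
    rw [hblock J ⟨i, hi⟩, hblock J' ⟨i', hi'⟩, BlockCompat, ← hD, hidx, hidx, hhi, hlo]
    exact ⟨fun h => by rw [Fin.ext h], fun h => by rw [h]⟩
  refine ⟨Finset.univ.image vertex, ?_, ?_, ?_⟩
  · intro u hu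
    obtain ⟨J, -, rfl⟩ := Finset.mem_image.1 hu
    exact Fin.is_lt _
  · rw [Finset.card_image_of_injective _ hinj]
    simp [cliqueSize]
  · intro u hu w hw _
    obtain ⟨J, -, rfl⟩ := Finset.mem_image.1 hu
    obtain ⟨J', -, rfl⟩ := Finset.mem_image.1 hw
    refine ⟨⟨fun i hi => ?_, hdig J J, fun e _ h => ?_⟩, hdig J J'⟩
    · rw [hblock J ⟨i, hi⟩, BlockValid, ← hD, hidx, hhi, hlo]
      exact ⟨hL.strictMono (Nat.lt_succ_self _), fun h => by rw [h, hL.zero],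
        fun h => by rw [h, hL.last]⟩
    · convert hL.holds (x.assignment m e) using 2 with v
      obtain ⟨j, hj⟩ := hatom J v
      obtain ⟨h₁, h₂⟩ := h v
      have h₃ := tupleNum_le fun i => x.assignment m e (v i)
      rw [hj, ← hD, hlo] at h₁
      rw [hj, ← hD, hhi] at h₂
      rw [hj, ← hD, hlo]
      constructor
      · intro h
        refine ⟨j, ?_, h⟩
        by_contra hk
        have : (j : ℕ) = x.k + 1 := by omega
        rw [this, hL.last] at h
        omega
      · rintro ⟨i, -, hi⟩
        rw [← hi] at h₁ h₂ ⊢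
        have h₁ := hL.strictMono.le_iff_le.1 h₁
        have h₂ := hL.strictMono.lt_iff_lt.1 h₂
        rw [show (j : ℕ) = i by omega]

/-- A clique yields a solution. By the number of its vertices it contains a vertex for every
sequence of indices, and all its vertices take their blocks from one sequence of blocks. -/
theorem exists_isSolution_of_clique {B : Finset ℕ} (hB : ∀ u ∈ B, u < x.numVertices s m)
    (hcard : B.card = x.cliqueSize s m)
    (hcl : ∀ u ∈ B, ∀ w ∈ B, u ≠ w → x.VertexCompat ψ u w) : ∃ L, x.IsSolution ψ L := by
  classical
  set D := x.blockBase s with hD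
  have hvalid : ∀ u ∈ B, x.VertexValid ψ u := by
    intro u hu
    obtain ⟨w, hw, hwu⟩ := Finset.exists_mem_ne
      (show 1 < B.card from hcard ▸ (x.two_le_cliqueSize : 2 ≤ x.cliqueSize s m)) u
    exact (hcl u hu w hw hwu.symm).1
  have hdig : ∀ u ∈ B, ∀ w ∈ B, x.DigitsCompat s m u w := by
    intro u hu w hw
    by_cases huw : u = w
    · exact huw ▸ (hvalid u hu).2.1
    · exact (hcl u hu w hw huw).2
  let idx : ℕ → Fin (numDigits s m) → Fin (x.k + 2) := fun u i =>
    ⟨blockIdx D (x.block s u i), x.blockIdx_block_lt u i⟩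
  have hinj : Set.InjOn idx B := by
    intro u hu w hw h
    refine eq_of_digit_eq (hB u hu) (hB w hw) fun i hi => ?_
    exact (hdig u hu w hw i hi i hi).1 (Fin.ext_iff.1 (congrFun h ⟨i, hi⟩))
  have himage : B.image idx = Finset.univ := by
    rw [← Finset.card_eq_iff_eq_univ, Finset.card_image_of_injOn hinj, hcard]
    simp [cliqueSize]
  have hsurj : ∀ J, ∃ u ∈ B, idx u = J := fun J =>
    Finset.mem_image.1 (himage ▸ Finset.mem_univ J)
  have hpos : 0 < numDigits s m := Nat.succ_pos _
  -- The block with index `j` is read off from a vertex all of whose blocks have index `j`.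
  have hβ : ∀ j, ∃ b, j < x.k + 2 → ∃ u ∈ B, x.block s u 0 = b ∧ blockIdx D b = j := by
    intro j
    by_cases hj : j < x.k + 2
    · obtain ⟨u, hu, h⟩ := hsurj fun _ => ⟨j, hj⟩
      exact ⟨_, fun _ => ⟨u, hu, rfl, Fin.ext_iff.1 (congrFun h ⟨0, hpos⟩)⟩⟩
    · exact ⟨0, fun h => absurd h hj⟩
  choose β hβ using hβ
  have hblock : ∀ u ∈ B, ∀ i < numDigits s m,
      x.block s u i = β (blockIdx D (x.block s u i)) := by
    intro u hu i hi
    obtain ⟨w, hw, hwβ, hj⟩ := hβ _ (x.blockIdx_block_lt u i)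
    rw [← hwβ] at hj ⊢
    exact (hdig u hu w hw i hi 0 hpos).1 hj.symm
  have hβvalid : ∀ j < x.k + 2, x.BlockValid s (β j) := by
    intro j hj
    obtain ⟨w, hw, hwβ, -⟩ := hβ _ hj
    exact hwβ ▸ (hvalid w hw).1 0 hpos
  have hβidx : ∀ j < x.k + 2, blockIdx D (β j) = j := fun j hj => (hβ j hj).choose_spec.2.2
  have hβnext : ∀ j < x.k + 1, blockHi D (β j) = blockLo D (β (j + 1)) := by
    intro j hj
    obtain ⟨u, hu, huβ, hj₁⟩ := hβ j (by omega)
    obtain ⟨w, hw, hwβ, hj₂⟩ := hβ (j + 1) (by omega)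
    have := (hdig u hu w hw 0 hpos 0 hpos).2
    rw [huβ, hwβ, ← hD, hj₁, hj₂] at this
    exact this rfl
  let L : ℕ → ℕ := fun j => if j ≤ x.k + 1 then blockLo D (β j) else x.n ^ s + (j - x.k)
  have hLβ : ∀ j ≤ x.k + 1, L j = blockLo D (β j) := fun j hj => if_pos hj
  have hLn : ∀ j, x.k + 1 < j → L j = x.n ^ s + (j - x.k) := fun j hj => if_neg (by omega)
  have hzero : L 0 = 0 := by
    rw [hLβ 0 (by omega)]
    exact (hβvalid 0 (by omega)).2.1 (hβidx 0 (by omega))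
  have hlast : L (x.k + 1) = x.n ^ s + 1 := by
    rw [hLβ _ le_rfl]
    exact (hβvalid _ (by omega)).2.2 (hβidx _ (by omega))
  have hhi : ∀ j ≤ x.k, blockHi D (β j) = L (j + 1) := fun j hj => by
    rw [hLβ _ (by omega), hβnext j (by omega)]
  have hmono : StrictMono L := by
    refine strictMono_nat_of_lt_succ fun j => ?_
    rcases lt_trichotomy j (x.k + 1) with hj | rfl | hj
    · rw [← hhi j (by omega), hLβ j (by omega)]
      exact (hβvalid j (by omega)).1
    · rw [hlast, hLn _ (by omega)]
      omega
    · rw [hLn j hj, hLn _ (by omega)]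
      omega
  refine ⟨L, hmono, hzero, hlast, by rw [hLn _ (by omega)]; omega, fun a => ?_⟩
  obtain ⟨e, he, rfl⟩ := x.exists_assignment_eq a
  -- The vertex of the clique whose blocks contain the tuples of the assignment checks the formula.
  have hJ : ∀ v : Fin s → Fin m, ∃ j ≤ x.k,
      L j ≤ tupleNum (fun i => x.assignment m e (v i)) ∧
      tupleNum (fun i => x.assignment m e (v i)) < L (j + 1) := fun v =>
    exists_mem_Ico_succ (by rw [hzero]; exact Nat.zero_le _)
      (by rw [hlast]; exact Nat.lt_succ_of_le (tupleNum_le _))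
  choose J hJk hJ₁ hJ₂ using hJ
  obtain ⟨u, hu, hidx⟩ := hsurj fun i =>
    if hi : (i : ℕ) < m ^ s then
      ⟨J (finFunctionFinEquiv.symm ⟨i, hi⟩), Nat.lt_succ_of_le ((hJk _).trans (Nat.le_succ _))⟩
    else 0
  have hatom : ∀ v : Fin s → Fin m, x.atomBlock u v = β (J v) := by
    intro v
    have hlt : (finFunctionFinEquiv v : ℕ) < m ^ s := Fin.is_lt _
    rw [atomBlock, hblock u hu _ (Nat.lt_succ_of_lt hlt)]
    have := congrArg Fin.val (congrFun hidx ⟨finFunctionFinEquiv v, Nat.lt_succ_of_lt hlt⟩)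
    simp only [idx, dif_pos hlt, Fin.eta, Equiv.symm_apply_apply] at this
    rw [this]
  have h := (hvalid u hu).2.2 e he fun v => by
    rw [hatom, ← hD, hhi _ (hJk v), ← hLβ _ ((hJk v).trans (Nat.le_succ _))]
    exact ⟨hJ₁ v, hJ₂ v⟩
  convert h using 2 with v
  rw [hatom, ← hD, ← hLβ _ ((hJk v).trans (Nat.le_succ _))]
  constructor
  · rintro ⟨j, -, hj⟩
    have h₁ := hJ₁ v
    have h₂ := hJ₂ v
    rw [← hj] at h₁ h₂ ⊢
    have h₁ := hmono.le_iff_le.1 h₁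
    have h₂ := hmono.lt_iff_lt.1 h₂
    rw [show J v = j by omega]
  · exact fun h => ⟨J v, hJk v, h⟩

theorem exists_clique_iff :
    (∃ B : Finset ℕ, (∀ u ∈ B, u < x.numVertices s m) ∧ B.card = x.cliqueSize s m ∧
      ∀ u ∈ B, ∀ w ∈ B, u ≠ w → x.VertexCompat ψ u w) ↔ ∃ L, x.IsSolution ψ L :=
  ⟨fun ⟨_, hB, hcard, hcl⟩ => x.exists_isSolution_of_clique ψ hB hcard hcl,
    fun ⟨_, hL⟩ => hL.exists_clique⟩

end WDInstance

/-! ### The reduction is given by terms -/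

section Reduction

variable {τ : List ℕ} {s m : ℕ} {α : Type} [TermContext τ α] {u w : α → ℕ}

namespace Expressible

theorem tupleNum {v : ∀ y : α, Fin s → Fin (inst y).n}
    (hv : ∀ i, Expressible fun y => (v y i : ℕ)) : Expressible fun y => tupleNum (v y) :=
  ((sum Finset.univ fun i => (hv i).mul (univ.pow i)).add (const 1)).congr fun y => by
    rw [_root_.tupleNum, finFunctionFinEquiv_apply]

theorem assignment (hu : Expressible u) (p : Fin m) :
    Expressible fun y => ((inst y).assignment m (u y) p : ℕ) :=
  (hu.div (univ.pow p) fun y => pow_pos (inst y).n_pos _).mod univ fun y => (inst y).n_pos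

theorem blockBase : Expressible fun y : α => (inst y).blockBase s := (univ.pow s).add (const 3)

theorem numBlocks : Expressible fun y : α => (inst y).numBlocks s :=
  (weight.add (const 2)).mul (blockBase.mul blockBase)

theorem block (hu : Expressible u) (s i : ℕ) :
    Expressible fun y => (inst y).block s (u y) i :=
  (hu.div (numBlocks.pow i) fun y => pow_pos (inst y).numBlocks_pos _).mod numBlocks
    fun y => (inst y).numBlocks_pos

theorem blockIdx (hu : Expressible u) :
    Expressible fun y => blockIdx ((inst y).blockBase s) (u y) :=
  hu.div (blockBase.mul blockBase) fun _ => Nat.mul_pos (Nat.succ_pos _) (Nat.succ_pos _)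

theorem blockLo (hu : Expressible u) : Expressible fun y => blockLo ((inst y).blockBase s) (u y) :=
  (hu.div blockBase fun _ => Nat.succ_pos _).mod blockBase fun _ => Nat.succ_pos _

theorem blockHi (hu : Expressible u) : Expressible fun y => blockHi ((inst y).blockBase s) (u y) :=
  hu.mod blockBase fun _ => Nat.succ_pos _

end Expressible

namespace ExpressiblePred

theorem holdsWith {mem : α → (Fin s → Fin m) → Prop} {a : ∀ y : α, Fin m → Fin (inst y).n}
    (hmem : ∀ v, ExpressiblePred fun y => mem y v) (ha : ∀ i, Expressible fun y => (a y i : ℕ))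
    (ψ : QFree τ s m) : ExpressiblePred fun y => ψ.HoldsWith (inst y) (mem y) (a y) := by
  induction ψ with
  | eq i j => exact (ExpressiblePred.eq (ha i) (ha j)).congr fun y => Fin.val_inj
  | rel q v => exact .rel q fun i => ha (v i)
  | X v => exact hmem v
  | neg φ ih => exact ih.not
  | and φ ψ ihφ ihψ => exact ihφ.and ihψ

theorem blockCompat (hu : Expressible u) (hw : Expressible w) :
    ExpressiblePred fun y => (inst y).BlockCompat s (u y) (w y) :=
  ((ExpressiblePred.eq hu.blockIdx hw.blockIdx).imp (.eq hu hw)).and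
    ((ExpressiblePred.eq hw.blockIdx (hu.blockIdx.add (.const 1))).imp (.eq hu.blockHi hw.blockLo))

theorem blockValid (hu : Expressible u) :
    ExpressiblePred fun y => (inst y).BlockValid s (u y) :=
  (ExpressiblePred.lt hu.blockLo hu.blockHi).and
    (((ExpressiblePred.eq hu.blockIdx (.const 0)).imp (.eq hu.blockLo (.const 0))).and
      ((ExpressiblePred.eq hu.blockIdx (Expressible.weight.add (.const 1))).imp
        (.eq hu.blockLo ((Expressible.univ.pow s).add (.const 1)))))

theorem digitsCompat (hu : Expressible u) (hw : Expressible w) :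
    ExpressiblePred fun y => (inst y).DigitsCompat s m (u y) (w y) := by
  refine (ExpressiblePred.forall_fintype
    (ι := Fin (WDInstance.numDigits s m) × Fin (WDInstance.numDigits s m)) fun i =>
      blockCompat (s := s) (hu.block s i.1) (hw.block s i.2)).congr fun y => ?_
  exact ⟨fun h i hi i' hi' => h (⟨i, hi⟩, ⟨i', hi'⟩), fun h i => h _ i.1.2 _ i.2.2⟩

theorem formulaCheck (ψ : QFree τ s m) (hu : Expressible u) :
    ExpressiblePred fun y => (inst y).FormulaCheck ψ (u y) := by
  have ha : ∀ p : Fin m, Expressible fun y : α × ℕ => ((inst y).assignment m y.2 p : ℕ) :=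
    Expressible.assignment .snd
  have ht : ∀ v : Fin s → Fin m,
      Expressible fun y : α × ℕ => tupleNum fun i => (inst y).assignment m y.2 (v i) := fun v =>
    Expressible.tupleNum fun i => ha (v i)
  have hb : ∀ v : Fin s → Fin m, Expressible fun y : α × ℕ => (inst y).atomBlock (u y.1) v :=
    fun v => hu.comp_fst.block s _
  exact ExpressiblePred.ball (Expressible.univ.pow m)
    ((ExpressiblePred.forall_fintype fun v =>
      (ExpressiblePred.le (hb v).blockLo (ht v)).and (.lt (ht v) (hb v).blockHi)).imp
      (holdsWith (fun v => .eq (hb v).blockLo (ht v)) ha ψ))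

theorem vertexCompat (ψ : QFree τ s m) (hu : Expressible u) (hw : Expressible w) :
    ExpressiblePred fun y => (inst y).VertexCompat ψ (u y) (w y) := by
  refine ((ExpressiblePred.forall_fintype (ι := Fin (WDInstance.numDigits s m)) fun i =>
    blockValid (s := s) (hu.block s i)).congr fun y => ?_).and
      ((digitsCompat hu hu).and (formulaCheck ψ hu)) |>.and (digitsCompat hu hw)
  exact ⟨fun h i hi => h ⟨i, hi⟩, fun h i => h i i.2⟩

end ExpressiblePred

namespace Expressible

theorem numVertices : Expressible fun y : α => (inst y).numVertices s m := numBlocks.pow _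

theorem starKeyFst (ψ : QFree τ s m) (c : ℕ) (hu : Expressible u) (hw : Expressible w) :
    Expressible fun y => starKeyFst ((inst y).numVertices s m) ((inst y).numVertices s m ^ c)
      ((inst y).VertexCompat ψ) (u y) (w y) := by
  classical
  have hM : Expressible fun y : α => (inst y).numVertices s m ^ c := numVertices.pow c
  exact ite (.eq hw hu) (const 0) (ite ((ExpressiblePred.lt hw numVertices).and
    (ExpressiblePred.vertexCompat ψ hu hw).not) (hM.add hw) (((const 3).mul hM).add hw))

theorem starKeySnd (ψ : QFree τ s m) (c : ℕ) (hu : Expressible u) (hw : Expressible w) :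
    Expressible fun y => starKeySnd ((inst y).numVertices s m) ((inst y).numVertices s m ^ c)
      ((inst y).VertexCompat ψ) (u y) (w y) := by
  classical
  have hM : Expressible fun y : α => (inst y).numVertices s m ^ c := numVertices.pow c
  exact ite (.le numVertices hw) (hM.sub hw) (ite (.eq hw hu) ((const 2).mul hM)
    (ite (ExpressiblePred.vertexCompat ψ hu hw).not (hM.add hw) (((const 3).mul hM).add hw)))

end Expressible

/-- The words of the permutations of `Fin M` with the sorting keys `key 0, …, key (V - 1)`, one
after the other. -/
def keyWords (key : ℕ → ℕ → ℕ) (V M : ℕ) : List ℕ :=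
  (List.range V).flatMap fun i => (List.range M).flatMap fun j => [∑ w ∈ Finset.range M,
    if ∑ v ∈ Finset.range M, (if key i v < key i w then 1 else 0) = j then w else 0]

theorem flatten_permOfKey_eq_keyWords {V M : ℕ} {key : ℕ → ℕ → ℕ}
    (hkey : ∀ i, Set.InjOn (key i) (Set.Iio M)) :
    (List.ofFn fun i : Fin V => List.ofFn fun j : Fin M =>
      (permOfKey (key i) (hkey i) j : ℕ)).flatten = keyWords key V M := by
  have h : ∀ {β : Type} (n : ℕ) (g : ℕ → β), (List.ofFn fun i : Fin n => g i)
      = (List.range n).map g := fun n g => by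
    apply List.ext_getElem <;> simp
  simp only [permOfKey_apply]
  rw [h V fun i => List.ofFn fun j : Fin M => ∑ w ∈ Finset.range M,
    if ∑ v ∈ Finset.range M, (if key i v < key i w then 1 else 0) = (j : ℕ) then w else 0,
    keyWords, List.flatMap_def]
  congr 2
  funext i
  rw [h M fun j => ∑ w ∈ Finset.range M,
    if ∑ v ∈ Finset.range M, (if key i v < key i w then 1 else 0) = j then w else 0,
    ← List.flatMap_pure_eq_map]
  rfl

theorem ExpressibleList.keyWords {key : WDInstance τ → ℕ → ℕ → ℕ} {V M : WDInstance τ → ℕ}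
    (hkey : ∀ {α : Type} [TermContext τ α] {u w : α → ℕ}, Expressible u → Expressible w →
      Expressible fun y => key (inst y) (u y) (w y))
    (hV : Expressible V) (hM : Expressible M) :
    ExpressibleList fun x => keyWords (key x) (V x) (M x) := by
  have hM₂ : Expressible fun y : (WDInstance τ × ℕ) × ℕ => M y.1.1 := hM.comp_fst.comp_fst
  have hsum : Expressible fun y : ((WDInstance τ × ℕ) × ℕ) × ℕ => ∑ v ∈ Finset.range (M y.1.1.1),
      if key y.1.1.1 y.1.1.2 v < key y.1.1.1 y.1.1.2 y.2 then 1 else 0 :=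
    Expressible.sum_range (F := fun (y : ((WDInstance τ × ℕ) × ℕ) × ℕ) v =>
        if key y.1.1.1 y.1.1.2 v < key y.1.1.1 y.1.1.2 y.2 then 1 else 0) hM₂.comp_fst
      (.ite (.lt (hkey Expressible.snd.comp_fst.comp_fst.comp_fst .snd)
        (hkey Expressible.snd.comp_fst.comp_fst .snd).comp_fst) (.const 1) (.const 0))
  have hletter : Expressible fun y : (WDInstance τ × ℕ) × ℕ => ∑ w ∈ Finset.range (M y.1.1),
      if ∑ v ∈ Finset.range (M y.1.1),
        (if key y.1.1 y.1.2 v < key y.1.1 y.1.2 w then 1 else 0) = y.2 then w else 0 :=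
    Expressible.sum_range (F := fun (y : (WDInstance τ × ℕ) × ℕ) w =>
      if ∑ v ∈ Finset.range (M y.1.1),
        (if key y.1.1 y.1.2 v < key y.1.1 y.1.2 w then 1 else 0) = y.2 then w else 0) hM₂
      (.ite (.eq hsum Expressible.snd.comp_fst) .snd (.const 0))
  exact flatMap_range (F := fun x i => (List.range (M x)).flatMap fun j =>
      [∑ w ∈ Finset.range (M x), if ∑ v ∈ Finset.range (M x),
        (if key x i v < key x i w then 1 else 0) = j then w else 0]) hV
    (flatMap_range (F := fun (y : WDInstance τ × ℕ) j => [∑ w ∈ Finset.range (M y.1),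
      if ∑ v ∈ Finset.range (M y.1), (if key y.1 y.2 v < key y.1 y.2 w then 1 else 0) = j
        then w else 0]) hM.comp_fst (singleton hletter))

/-- The instance of the largest fixed subset problem produced from a structure. -/
noncomputable def reduction (ψ : QFree τ s m) (c : ℕ) (x : WDInstance τ) : LFSDInstance :=
  starInstance (x.numVertices s m) c (x.cliqueSize s m) (x.VertexCompat ψ)

theorem exists_expressibleList_encode_reduction (ψ : QFree τ s m) (c : ℕ) :
    ∃ u : WDInstance τ → List ℕ, ExpressibleList u ∧
      ∀ x, (reduction ψ c x).encode = encodeNats (u x) := by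
  let V : WDInstance τ → ℕ := fun x => x.numVertices s m
  have hV : Expressible V := Expressible.numVertices
  have hl : Expressible fun x : WDInstance τ => x.cliqueSize s m :=
    (Expressible.weight.add (.const 2)).pow _
  have h₁ : ExpressibleList fun x =>
      keyWords (starKeyFst (V x) (V x ^ c) (x.VertexCompat ψ)) (V x) (V x ^ c) :=
    .keyWords (fun hu hw => Expressible.starKeyFst ψ c hu hw) hV (hV.pow c)
  have h₂ : ExpressibleList fun x =>
      keyWords (starKeySnd (V x) (V x ^ c) (x.VertexCompat ψ)) (V x) (V x ^ c) :=
    .keyWords (fun hu hw => Expressible.starKeySnd ψ c hu hw) hV (hV.pow c)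
  refine ⟨_, (ExpressibleList.singleton (hV.pow c)).append ((ExpressibleList.singleton hV).append
    ((ExpressibleList.singleton hl).append (h₁.append h₂))), fun x => ?_⟩
  have h := congrArg₂ (fun a b => encodeNats (V x ^ c :: V x :: x.cliqueSize s m :: (a ++ b)))
    (flatten_permOfKey_eq_keyWords (V := V x)
      (starKeyFst_injOn (V x) (x.VertexCompat ψ) (V x ^ c)))
    (flatten_permOfKey_eq_keyWords (V := V x)
      (starKeySnd_injOn (V x) (x.VertexCompat ψ) (V x ^ c)))
  exact h

theorem exists_isFeasible_reduction_iff (ψ : QFree τ s m) {c : ℕ} (hc : 1 ≤ c)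
    (x : WDInstance τ) :
    (∃ S : Finset (Fin s → Fin x.n), S.card = x.k ∧ ∀ a : Fin m → Fin x.n, ψ.Holds x S a) ↔
      ∃ B : Finset (Fin (reduction ψ c x).n), B.card = (reduction ψ c x).l ∧
        IsFeasible (reduction ψ c x).Γs (reduction ψ c x).Γt B :=
  (x.exists_isSolution_iff ψ).symm.trans ((x.exists_clique_iff ψ).symm.trans
    (exists_isFeasible_starInstance_iff x.numVertices_pos hc x.two_le_cliqueSize).symm)

end Reduction

/-! ### Composition of reductions -/

theorem Polynomial.eval_mul_le (p : Polynomial ℕ) (y z : ℕ) :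
    p.eval (y * z) ≤ p.eval y * p.eval z := by
  induction p using Polynomial.induction_on' with
  | add p q hp hq =>
    simp only [Polynomial.eval_add]
    nlinarith [Nat.zero_le (p.eval y * q.eval z), Nat.zero_le (q.eval y * p.eval z)]
  | monomial n a =>
    simp only [Polynomial.eval_monomial, mul_pow]
    calc a * (y ^ n * z ^ n) ≤ a * a * (y ^ n * z ^ n) :=
          Nat.mul_le_mul_right _ (Nat.le_mul_self a)
      _ = a * y ^ n * (a * z ^ n) := by ring

theorem Polynomial.primrec_eval (p : Polynomial ℕ) : Primrec fun n => p.eval n := by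
  induction p using Polynomial.induction_on' with
  | add p q hp hq => simpa only [Polynomial.eval_add] using Primrec.nat_add.comp hp hq
  | monomial n a =>
    simp only [Polynomial.eval_monomial]
    refine Primrec.nat_mul.comp (Primrec.const a) ?_
    induction n with
    | zero => simpa using Primrec.const 1
    | succ n ih =>
      simp only [pow_succ]
      exact Primrec.nat_mul.comp ih Primrec.id

/-- An fpt-reduction to a weighted definability problem can be followed by any reduction that is
given by a scheme and increases the parameter polynomially. -/
theorem FPTReducible.trans_expressible {A B : ParamProblem} {τ : List ℕ} {s m : ℕ}
    {ψ : QFree τ s m} (hA : FPTReducible A (weightedDef τ s m ψ)) (R : WDInstance τ → B.Inst)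
    {u : WDInstance τ → List ℕ} (hu : ExpressibleList u)
    (henc : ∀ x, B.encode (R x) = encodeNats (u x))
    (hyes : ∀ x, (weightedDef τ s m ψ).yes x ↔ B.yes (R x)) (g : Polynomial ℕ)
    (hparam : ∀ x, B.param (R x) ≤ g.eval x.k) : FPTReducible A B := by
  obtain ⟨R₀, P, f, h, p, hf, hh, hyes₀, hP, hparam₀⟩ := hA
  obtain ⟨o, ho⟩ := hu
  obtain ⟨q, hq⟩ := o.exec_compile
  obtain ⟨b, hb⟩ := P.exists_below
  replace hb : P.Below (b + 1) := hb.mono (Nat.le_succ b)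
  let r : Polynomial ℕ := 2 * .X + (1 + q)
  -- Register `b + 2` is set to `0`, the value of all free variables of the scheme.
  refine ⟨fun x => R (R₀ x), .seq (P.redirect (b + 1)) (.seq (.assign (b + 2) (.const 0))
      (o.compile (b + 1) (fun _ => b + 2) (b + 3))), fun k => r.eval (f k), fun k => g.eval (h k),
    r.comp p, r.primrec_eval.to_comp.comp hf, g.primrec_eval.to_comp.comp hh,
    fun x => (hyes₀ x).trans (hyes _), fun x => ?_,
    fun x => (hparam _).trans (g.eval_mono_nat (hparam₀ x))⟩
  set T := f (A.param x) * p.eval (A.encode x).length with hT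
  obtain ⟨hlen, t, z, ht, hE, hz, hzo⟩ := (hP x).hasWord (Nat.succ_pos b) hb
  obtain ⟨t', z', hE', ht', -, hz'⟩ := hq (b + 1) (R₀ x).encode (fun _ => b + 2) (fun _ => 0)
    (b + 3) { z with reg := Function.update z.reg (b + 2) 0 } T hlen (fun _ => Nat.zero_le _)
    ⟨⟨(Function.update_of_ne (by omega) _ _).trans hz.len, hz.bit⟩, by omega,
      fun _ => by omega, fun _ => by simp⟩
  refine ⟨_, z', ?_, hE.seq ((Exec.assign _ _ _).seq hE'), ?_⟩
  · refine le_trans ?_ (by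
      simpa only [Polynomial.eval_comp] using r.eval_mul_le (f (A.param x)) (p.eval _))
    rw [← hT]
    simp only [r, Polynomial.eval_add, Polynomial.eval_mul, Polynomial.eval_ofNat,
      Polynomial.eval_X, Polynomial.eval_one]
    omega
  · refine hz'.trans ?_
    rw [hzo, List.nil_append]
    exact (congrArg encodeNats (ho (R₀ x))).trans (henc (R₀ x)).symm

theorem theorem9 (c : ℕ) (hc : 1 ≤ c) : W1Hard (rootLFSD c) := by
  rintro A ⟨τ, s, m, ψ, hA⟩
  obtain ⟨u, hu, henc⟩ := exists_expressibleList_encode_reduction ψ c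
  refine hA.trans_expressible (B := rootLFSD c) (fun x => ⟨reduction ψ c x, rfl⟩) hu henc
    (exists_isFeasible_reduction_iff ψ hc) ((.X + 2) ^ WDInstance.numDigits s m) fun x => ?_
  simp [rootLFSD, reduction, starInstance, WDInstance.cliqueSize]
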